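/- For $x\in\{0,1\}^n$ let $|x|$ be its Hamming weight, and let $\mathcal B_m$ be the binomial distribution with parameters $m$ and $1/2$ on $\{0,\dots,m\}$. Let $\mathcal I$ be a partition of $[n]$ into an odd number $r$ of (possibly empty) parts and let $W\in\mathcal I$ be one of the parts (the workspace). The distribution $\mathcal D_{\mathcal I}^W$ on $\{0,1\}^n$ is defined as follows: pick $w\sim\mathcal B_n$ and output, if one exists, a uniformly random $x\in\{0,1\}^n$ with $|x|=w$ such that for every part $I\ne W$ of $\mathcal I$ the vector $x$ is constant on $I$; if no such $x$ exists, output the all-zeros vector. Let $\mathcal D_{n,r}$ be the law of $x\sim\mathcal D_{\mathcal I}^W$ when $\mathcal I$ is a random partition of $[n]$ into $r$ parts (each element of $[n]$ is put independently into a uniformly random one of the $r$ parts) and $W$ is, independently, a uniformly random one of the $r$ parts. Let $d_{TV}$ denote total variation distance. 1. The law $\mathcal D_{n,r}$ is $o(1/n)$-close to uniform on $\{0,1\}^n$, uniformly in $r$: for every $\varepsilon>0$ there is $N$ such that for all $n\ge N$ and all odd $r\ge1$, $$d_{TV}\bigl(\mathcal D_{n,r},\ \mathrm{Unif}(\{0,1\}^n)\bigr)\le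 \frac{\varepsilon}{n}.$$ 2. For every $0<c<1$ there is a constant $C>0$, depending only on $c$, such that for all $n\ge k\ge1$, every set $J=\{j_1,\dots,j_k\}\subseteq[n]$ of size $k$ and every odd $r\ge Ck^2$: if $x\sim\mathcal D_{n,r}$, then the law of $(x_J,|x_{[n]\setminus J}|)$ is at total variation distance at most $c/k$ from $\mathcal D^*_{k,n}$, the distribution on $\{0,1\}^k\times\{0,\dots,n-k\}$ of a pair whose first component is uniform on $\{0,1\}^k$ and whose second component is, independently, distributed as $\mathcal B_{n-k}$. -/

import Mathlib

noncomputable section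

/-- Total variation (statistical) distance of two probability distributions on a finite set. -/
def tvDist {α : Type*} [Fintype α] (p q : PMF α) : ℝ :=
  (1 / 2) * ∑ a, |(p a).toReal - (q a).toReal|

lemma sum_choose_div_two_pow (m : ℕ) :
    ∑ i : Fin (m + 1), ((m.choose i : ℕ) : ENNReal) / 2 ^ m = 1 := by
  have h : ∑ i : Fin (m + 1), m.choose i = 2 ^ m := by
    rw [Fin.sum_univ_eq_sum_range (fun i => m.choose i), Nat.sum_range_choose]
  simp_rw [div_eq_mul_inv]
  rw [← Finset.sum_mul, ← Nat.cast_sum, h]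
  push_cast
  exact ENNReal.mul_inv_cancel (by simp) (by simp)

/-- The binomial distribution with parameters `m` and `1/2`, over `{0, …, m}`. -/
def binomialHalf (m : ℕ) : PMF (Fin (m + 1)) :=
  PMF.ofFintype (fun i => ((m.choose i : ℕ) : ENNReal) / 2 ^ m) (sum_choose_div_two_pow m)

/-- Hamming weight of `x ∈ {0,1}^n`. -/
def hammingWt {n : ℕ} (x : Fin n → Bool) : ℕ :=
  (Finset.univ.filter fun i => x i = true).card

/-- A partition of `[n]` into `r` (possibly empty) parts is given by the map `P` sending each element
to the label of its part. `feasibleInputs P W w` is the set of `x ∈ {0,1}^n` of Hamming weight `w`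
which are constant on every part other than the workspace `W`. -/
def feasibleInputs {n r : ℕ} (P : Fin n → Fin r) (W : Fin r) (w : ℕ) : Finset (Fin n → Bool) :=
  Finset.univ.filter fun x => hammingWt x = w ∧
    ∀ a : Fin r, a ≠ W → (∀ i, P i = a → x i = false) ∨ (∀ i, P i = a → x i = true)

open Classical in
/-- The distribution `D_I^W` for a fixed partition `P` and workspace `W`: draw a binomial weight `w`
and return a uniformly random feasible input of weight `w`, or the zero vector if there is none. -/
def workspaceDist {n r : ℕ} (P : Fin n → Fin r) (W : Fin r) : PMF (Fin n → Bool) :=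
  (binomialHalf n).bind fun w =>
    if h : (feasibleInputs P W w).Nonempty then PMF.uniformOfFinset (feasibleInputs P W w) h
    else PMF.pure fun _ => false

/-- The law of `x ∼ D_I^W` for a random partition of `[n]` into `r` parts (every element is put
independently into a uniformly random part) and an independent uniformly random workspace. -/
def randomWorkspaceDist (n r : ℕ) [NeZero r] : PMF (Fin n → Bool) :=
  (PMF.uniformOfFintype (Fin n → Fin r)).bind fun P =>
    (PMF.uniformOfFintype (Fin r)).bind fun W => workspaceDist P W

/-- The number of ones of `x` outside `J = {J 0, …, J (k-1)}`. -/
def outsideWt {n k : ℕ} (J : Fin k ↪ Fin n) (x : Fin n → Bool) : ℕ :=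
  (Finset.univ.filter fun i => i ∉ Set.range J ∧ x i = true).card

lemma outsideWt_lt {n k : ℕ} (J : Fin k ↪ Fin n) (x : Fin n → Bool) :
    outsideWt J x < n - k + 1 := by
  have h : (Finset.univ.filter fun i => i ∉ Set.range J ∧ x i = true) ⊆
      (Finset.univ.map J)ᶜ := by
    intro i hi
    simp only [Finset.mem_filter, Finset.mem_univ, true_and] at hi
    simpa using hi.1
  have h2 := Finset.card_le_card h
  rw [Finset.card_compl, Finset.card_map, Finset.card_univ, Fintype.card_fin,
    Fintype.card_fin] at h2
  exact Nat.lt_succ_of_le h2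

/-- The pair `(x_J, |x_{[n] ∖ J}|) ∈ {0,1}^k × {0, …, n - k}`. -/
def coreInput {n k : ℕ} (J : Fin k ↪ Fin n) (x : Fin n → Bool) :
    (Fin k → Bool) × Fin (n - k + 1) :=
  (fun j => x (J j), ⟨outsideWt J x, outsideWt_lt J x⟩)

/-- `D*_{k,n}`: uniform over `{0,1}^k` and, independently, binomial over `{0, …, n - k}`. -/
def coreDist (k n : ℕ) : PMF ((Fin k → Bool) × Fin (n - k + 1)) :=
  (PMF.uniformOfFintype (Fin k → Bool)).bind fun y =>
    (binomialHalf (n - k)).bind fun w => PMF.pure (y, w)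

end

/-! ### Reduction of both claims to the probability that a weight is infeasible -/

section Reduction

open Finset
open scoped BigOperators

/-! Uniform relabelling of `[n]` preserves the law of the random partition. So, for a given weight
and conditionally on feasibility, the output is uniform on that slice of the cube
(`feasibleMass_eq`). The distance to uniform is therefore at most the binomial average of the
infeasibility probabilities (`tvDist_randomWorkspaceDist_le`).

Giving each part other than the workspace a sign (all ones or all zeros), weight `w` is feasible
once a signed sum of part sizes approximates `2w - n` within the workspace size, or within 1. As `r`
is odd, the other parts can be paired; a pair contributes plus or minus its sum (equal signs) or its
difference (opposite signs), and greedy signs bring the error down to the largest step.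

Put `n = ν^5`; by Hoeffding only `|2w - n| ≤ ν^3` matters. If `r ≤ ν^4`, all parts have size near `n
/ r ≥ ν`, so pair differences fit in the workspace, which together with those differences covers the
target. If `r ≥ ν^4`, the workspace may be empty: pair sums give a coarse approximation, and many
reserved pairs of difference exactly one finish it. Pair differences are lazy random walks, studied
through cosines, second moment and unimodality; sums over pairs concentrate by bounded differences.
The failure probability is exponentially small in `n^(1/5)`, uniformly in `r`.

The target law of the second claim is the image of the uniform law under `coreInput`, so large `n`
follows from the first claim. For the remaining bounded `n`, a large `r` makes the partition
injective with high probability, and every weight is feasible. -/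

lemma PMF.toReal_bind_apply {α β : Type*} [Fintype α] (p : PMF α) (f : α → PMF β) (b : β) :
    (p.bind f b).toReal = ∑ a, (p a).toReal * (f a b).toReal := by
  rw [PMF.bind_apply, tsum_fintype, ENNReal.toReal_sum]
  · simp_rw [ENNReal.toReal_mul]
  · exact fun a _ => ENNReal.mul_ne_top (p.apply_ne_top a) ((f a).apply_ne_top b)

lemma PMF.toReal_uniformOfFintype_bind_apply {α β : Type*} [Fintype α] [Nonempty α]
    (f : α → PMF β) (b : β) :
    ((PMF.uniformOfFintype α).bind f b).toReal = 𝔼 a, (f a b).toReal := by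
  rw [PMF.toReal_bind_apply, Fintype.expect_eq_sum_div_card, Finset.sum_div]
  refine Finset.sum_congr rfl fun a _ => ?_
  rw [PMF.uniformOfFintype_apply, ENNReal.toReal_inv, ENNReal.toReal_natCast, div_eq_inv_mul]

lemma toReal_binomialHalf (m : ℕ) (i : Fin (m + 1)) :
    (binomialHalf m i).toReal = (m.choose i : ℝ) / 2 ^ m := by
  simp [binomialHalf, PMF.ofFintype_apply, ENNReal.toReal_div]

lemma PMF.sum_toReal {α : Type*} [Fintype α] (p : PMF α) : ∑ a, (p a).toReal = 1 := by
  rw [← ENNReal.toReal_sum fun a _ => p.apply_ne_top a, ← tsum_fintype (L := .unconditional α),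
    p.tsum_coe, ENNReal.toReal_one]

lemma card_filter_eq_true_eq (ι : Type*) [Fintype ι] [DecidableEq ι] (w : ℕ) :
    #{x : ι → Bool | #{i | x i = true} = w} = (Fintype.card ι).choose w := by
  rw [← Finset.card_univ (α := ι), ← Finset.card_powersetCard]
  refine Finset.card_nbij' (fun x => ({i | x i = true} : Finset ι))
    (fun s i => decide (i ∈ s)) ?_ ?_ ?_ ?_
  · intro x hx
    simpa [Finset.mem_powersetCard] using hx
  · intro s hs
    simpa [Finset.mem_powersetCard] using hs
  · intro x _
    ext i
    simp
  · intro s _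
    ext i
    simp

lemma card_filter_hammingWt_eq (n w : ℕ) :
    #{x : Fin n → Bool | hammingWt x = w} = n.choose w := by
  rw [← Fintype.card_fin n, ← card_filter_eq_true_eq, Fintype.card_fin]
  rfl

lemma exists_perm_of_hammingWt_eq {n : ℕ} {x y : Fin n → Bool} (h : hammingWt x = hammingWt y) :
    ∃ σ : Equiv.Perm (Fin n), y = x ∘ σ := by
  have hc : Fintype.card {i // y i = true} = Fintype.card {i // x i = true} := by
    simpa [hammingWt, Fintype.card_subtype] using h.symm
  let e : {i // y i = true} ≃ {i // x i = true} := Fintype.equivOfCardEq hc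
  refine ⟨e.extendSubtype, funext fun i => ?_⟩
  rw [Function.comp_apply]
  by_cases hi : y i = true
  · rw [hi]
    exact (e.extendSubtype_mem i hi).symm
  · have := e.extendSubtype_not_mem i hi
    rw [Bool.not_eq_true] at hi this
    rw [hi, this]

lemma hammingWt_comp_perm {n : ℕ} (x : Fin n → Bool) (σ : Equiv.Perm (Fin n)) :
    hammingWt (x ∘ σ) = hammingWt x := by
  unfold hammingWt
  refine Finset.card_nbij' σ σ.symm ?_ ?_ ?_ ?_ <;> intro i <;> simp

lemma comp_perm_mem_feasibleInputs {n r : ℕ} (P : Fin n → Fin r) (W : Fin r) (w : ℕ)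
    (σ : Equiv.Perm (Fin n)) (x : Fin n → Bool) :
    x ∘ σ ∈ feasibleInputs (P ∘ σ) W w ↔ x ∈ feasibleInputs P W w := by
  have key : ∀ a b, (∀ i, P (σ i) = a → x (σ i) = b) ↔ ∀ i, P i = a → x i = b := fun a b =>
    ⟨fun h i => by simpa using h (σ.symm i), fun h i => h (σ i)⟩
  simp only [feasibleInputs, Finset.mem_filter, Finset.mem_univ, true_and, hammingWt_comp_perm,
    Function.comp_apply, key]

lemma map_feasibleInputs {n r : ℕ} (P : Fin n → Fin r) (W : Fin r) (w : ℕ)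
    (σ : Equiv.Perm (Fin n)) :
    (feasibleInputs P W w).map (σ.symm.arrowCongr (Equiv.refl Bool)).toEmbedding =
      feasibleInputs (P ∘ σ) W w := by
  ext y
  rw [Finset.mem_map_equiv, ← comp_perm_mem_feasibleInputs P W w σ]
  have : (((σ.symm.arrowCongr (Equiv.refl Bool)).symm y) ∘ σ) = y := by
    ext i
    simp [Equiv.arrowCongr]
  rw [this]

/-- The weight-`w` part of the law of a random feasible input: the probability, over the partition,
of there being a feasible input and of `x` being the one drawn. -/
noncomputable def feasibleMass {n r : ℕ} (W : Fin r) (w : ℕ) (x : Fin n → Bool) : ℝ :=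
  𝔼 P : Fin n → Fin r,
    if x ∈ feasibleInputs P W w then ((#(feasibleInputs P W w) : ℝ))⁻¹ else 0

/-- The probability, over a random partition, that no input of weight `w` is feasible. -/
noncomputable def infeasibleProb (n : ℕ) {r : ℕ} (W : Fin r) (w : ℕ) : ℝ :=
  𝔼 P : Fin n → Fin r, if (feasibleInputs P W w).Nonempty then 0 else 1

lemma infeasibleProb_nonneg (n : ℕ) {r : ℕ} (W : Fin r) (w : ℕ) : 0 ≤ infeasibleProb n W w :=
  Finset.expect_nonneg fun P _ => by split_ifs <;> simp

lemma infeasibleProb_le_one (n : ℕ) {r : ℕ} (W : Fin r) (w : ℕ) : infeasibleProb n W w ≤ 1 := by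
  have : NeZero r := ⟨(W.pos).ne'⟩
  refine (Finset.expect_le_expect (g := fun _ => (1 : ℝ)) fun P _ => ?_).trans_eq
    (Fintype.expect_const 1)
  split_ifs <;> simp

/-- The substitution `P ↦ P ∘ σ` permutes the partitions and carries feasible sets bijectively to
feasible sets. -/
lemma feasibleMass_comp_perm {n r : ℕ} (W : Fin r) (w : ℕ) (x : Fin n → Bool)
    (σ : Equiv.Perm (Fin n)) : feasibleMass W w (x ∘ σ) = feasibleMass W w x := by
  unfold feasibleMass
  symm
  refine Fintype.expect_equiv (σ.symm.arrowCongr (Equiv.refl (Fin r))) _ _ fun P => ?_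
  have hP : σ.symm.arrowCongr (Equiv.refl (Fin r)) P = P ∘ σ := by
    ext i
    simp [Equiv.arrowCongr]
  rw [hP]
  simp only [comp_perm_mem_feasibleInputs]
  rw [← map_feasibleInputs P W w σ, Finset.card_map]

lemma sum_feasibleMass {n r : ℕ} (W : Fin r) (w : ℕ) :
    ∑ x : Fin n → Bool, feasibleMass W w x = 1 - infeasibleProb n W w := by
  have : NeZero r := ⟨(W.pos).ne'⟩
  unfold feasibleMass infeasibleProb
  rw [← Finset.expect_sum_comm, ← Fintype.expect_const (ι := Fin n → Fin r) (1 : ℝ),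
    ← Finset.expect_sub_distrib]
  refine Finset.expect_congr rfl fun P _ => ?_
  rw [Finset.sum_ite_mem, Finset.univ_inter, Finset.sum_const, nsmul_eq_mul]
  split_ifs with h
  · rw [mul_inv_cancel₀ (by simpa using h.ne_empty)]
    simp
  · simp [Finset.not_nonempty_iff_eq_empty.1 h]

/-- Inputs of equal weight differ by a permutation, so symmetry spreads the total mass of
`sum_feasibleMass` evenly over the slice. -/
lemma feasibleMass_eq {n r : ℕ} (W : Fin r) (w : ℕ) (x : Fin n → Bool) :
    feasibleMass W w x =
      (1 - infeasibleProb n W w) * if hammingWt x = w then ((n.choose w : ℝ))⁻¹ else 0 := by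
  have hz : ∀ y : Fin n → Bool, hammingWt y ≠ w → feasibleMass W w y = 0 := fun y hy =>
    Finset.expect_eq_zero fun P _ => if_neg (by simp [feasibleInputs, hy])
  split_ifs with h
  · have hs := sum_feasibleMass (n := n) W w
    rw [← Finset.sum_filter_add_sum_filter_not _ (fun y => hammingWt y = w),
      Finset.sum_eq_zero (s := univ.filter fun y => ¬hammingWt y = w)
        fun y hy => hz y (by simpa using hy), add_zero,
      Finset.sum_congr rfl (g := fun _ => feasibleMass W w x)] at hs
    · rw [Finset.sum_const, card_filter_hammingWt_eq, nsmul_eq_mul] at hs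
      have hpos : (n.choose w : ℝ) ≠ 0 := by
        rw [← card_filter_hammingWt_eq]
        exact_mod_cast (Finset.card_pos.2 ⟨x, by simpa using h⟩).ne'
      rw [← hs]
      field_simp
    · intro y hy
      obtain ⟨σ, rfl⟩ := exists_perm_of_hammingWt_eq
        (h.trans (by simpa using hy : hammingWt y = w).symm)
      exact feasibleMass_comp_perm W w x σ
  · rw [hz x h, mul_zero]

lemma hammingWt_lt {n : ℕ} (x : Fin n → Bool) : hammingWt x < n + 1 := by
  have := Finset.card_le_univ (univ.filter fun i => x i = true)
  rw [Fintype.card_fin] at this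
  exact Nat.lt_succ_of_le this

/-- The uniform law drawn weight first. -/
lemma toReal_uniform_eq_sum_hammingWt {n : ℕ} (x : Fin n → Bool) :
    (PMF.uniformOfFintype (Fin n → Bool) x).toReal = ∑ w : Fin (n + 1),
      (n.choose w : ℝ) / 2 ^ n * if hammingWt x = w then ((n.choose w : ℝ))⁻¹ else 0 := by
  rw [Finset.sum_eq_single (⟨hammingWt x, hammingWt_lt x⟩ : Fin (n + 1))]
  · have : (n.choose (hammingWt x) : ℝ) ≠ 0 := by
      exact_mod_cast (Nat.choose_pos (Nat.le_of_lt_succ (hammingWt_lt x))).ne'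
    simp only [PMF.uniformOfFintype_apply, if_true]
    field_simp
    simp
  · intro w _ hw
    rw [if_neg fun h => hw (Fin.ext h.symm), mul_zero]
  · simp

/-- Only an inequality: the mass that falls on the default zero vector is dropped. -/
lemma toReal_workspaceDist_ge {n r : ℕ} (P : Fin n → Fin r) (W : Fin r) (x : Fin n → Bool) :
    ∑ w : Fin (n + 1), (n.choose w : ℝ) / 2 ^ n *
      (if x ∈ feasibleInputs P W w then ((#(feasibleInputs P W w) : ℝ))⁻¹ else 0) ≤
    (workspaceDist P W x).toReal := by
  rw [workspaceDist, PMF.toReal_bind_apply]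
  refine Finset.sum_le_sum fun w _ => ?_
  rw [toReal_binomialHalf]
  refine mul_le_mul_of_nonneg_left ?_ (by positivity)
  by_cases hx : x ∈ feasibleInputs P W w
  · have hne : (feasibleInputs P W w).Nonempty := ⟨x, hx⟩
    rw [dif_pos hne, if_pos hx, PMF.uniformOfFinset_apply_of_mem _ hx, ENNReal.toReal_inv,
      ENNReal.toReal_natCast]
  · rw [if_neg hx]
    exact ENNReal.toReal_nonneg

/-- Since both laws have mass 1, one-sided deficits suffice: `|p - q| ≤ (p - q) + 2e`, and the sum
of `p - q` vanishes. -/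
lemma tvDist_le_of_sub_le {α : Type*} [Fintype α] (p q : PMF α) (e : α → ℝ) (he : ∀ a, 0 ≤ e a)
    (h : ∀ a, (q a).toReal - e a ≤ (p a).toReal) : tvDist p q ≤ ∑ a, e a := by
  have hpq : ∑ a, |(p a).toReal - (q a).toReal| ≤
      ∑ a, ((p a).toReal - (q a).toReal + 2 * e a) :=
    Finset.sum_le_sum fun a _ => by
      rw [abs_le]
      constructor <;> linarith [h a, he a]
  rw [Finset.sum_add_distrib, Finset.sum_sub_distrib, p.sum_toReal, q.sum_toReal,
    ← Finset.mul_sum] at hpq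
  unfold tvDist
  linarith

/-- The law of a random workspace input is as close to uniform as feasibility is likely. -/
lemma tvDist_randomWorkspaceDist_le (n r : ℕ) [NeZero r] :
    tvDist (randomWorkspaceDist n r) (PMF.uniformOfFintype (Fin n → Bool)) ≤
      ∑ w : Fin (n + 1), (n.choose w : ℝ) / 2 ^ n * 𝔼 W : Fin r, infeasibleProb n W w := by
  set f : ℕ → ℝ := fun w => 𝔼 W : Fin r, infeasibleProb n W w with hf
  set U : ℕ → (Fin n → Bool) → ℝ :=
    fun w x => if hammingWt x = w then ((n.choose w : ℝ))⁻¹ else 0 with hU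
  have hf0 : ∀ w, 0 ≤ f w := fun w => Finset.expect_nonneg fun W _ => infeasibleProb_nonneg n W w
  have hU0 : ∀ w x, 0 ≤ U w x := fun w x => by
    simp only [hU]
    split_ifs <;> positivity
  refine (tvDist_le_of_sub_le _ _
    (fun x => ∑ w : Fin (n + 1), (n.choose w : ℝ) / 2 ^ n * (f w * U w x)) (fun x => ?_)
    (fun x => ?_)).trans_eq ?_
  · exact Finset.sum_nonneg fun w _ => mul_nonneg (by positivity) (mul_nonneg (hf0 w) (hU0 w x))
  · rw [toReal_uniform_eq_sum_hammingWt, ← Finset.sum_sub_distrib, randomWorkspaceDist,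
      PMF.toReal_uniformOfFintype_bind_apply]
    simp_rw [PMF.toReal_uniformOfFintype_bind_apply]
    refine le_trans (le_of_eq ?_) (Finset.expect_le_expect fun P _ =>
      Finset.expect_le_expect fun W _ => toReal_workspaceDist_ge P W x)
    rw [Finset.expect_comm]
    simp_rw [Finset.expect_sum_comm, ← Finset.mul_expect]
    refine Finset.sum_congr rfl fun w _ => ?_
    rw [← mul_sub]
    congr 1
    have : ∀ W : Fin r, (𝔼 P : Fin n → Fin r, if x ∈ feasibleInputs P W w then
        ((#(feasibleInputs P W w) : ℝ))⁻¹ else 0) = (1 - infeasibleProb n W w) * U w x :=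
      fun W => feasibleMass_eq W w x
    simp_rw [this]
    rw [← Finset.expect_mul, Finset.expect_sub_distrib, Fintype.expect_const]
    simp only [hf, hU]
    ring
  · rw [Finset.sum_comm]
    refine Finset.sum_congr rfl fun w _ => ?_
    rw [← Finset.mul_sum, ← Finset.mul_sum]
    congr 1
    have h1 : ∑ x : Fin n → Bool, U w x = 1 := by
      have hc : (n.choose w : ℝ) ≠ 0 := by
        exact_mod_cast (Nat.choose_pos (Nat.le_of_lt_succ w.2)).ne'
      simp only [hU]
      rw [← Finset.sum_filter, Finset.sum_const, card_filter_hammingWt_eq, nsmul_eq_mul,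
        mul_inv_cancel₀ hc]
    rw [h1, mul_one]

lemma tvDist_map_le {α β : Type*} [Fintype α] [Fintype β] (p q : PMF α) (g : α → β) :
    tvDist (p.map g) (q.map g) ≤ tvDist p q := by
  classical
  have hmap : ∀ (s : PMF α) (b : β),
      (s.map g b).toReal = ∑ a, if b = g a then (s a).toReal else 0 := fun s b => by
    rw [PMF.map_apply, tsum_fintype, ENNReal.toReal_sum]
    · refine Finset.sum_congr rfl fun a _ => ?_
      split_ifs <;> simp
    · intro a _
      split_ifs
      exacts [s.apply_ne_top a, by simp]
  unfold tvDist
  refine mul_le_mul_of_nonneg_left ?_ (by norm_num)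
  calc ∑ b, |(p.map g b).toReal - (q.map g b).toReal|
      ≤ ∑ b, ∑ a, if b = g a then |(p a).toReal - (q a).toReal| else 0 := by
        refine Finset.sum_le_sum fun b _ => ?_
        rw [hmap, hmap, ← Finset.sum_sub_distrib]
        refine (Finset.abs_sum_le_sum_abs _ _).trans (Finset.sum_le_sum fun a _ => ?_)
        split_ifs <;> simp
    _ = ∑ a, |(p a).toReal - (q a).toReal| := by
        rw [Finset.sum_comm]
        simp

/-- Restriction to the complement of `J` identifies the fibre with the vectors of weight `w` there.
-/
lemma card_filter_coreInput_eq {n k : ℕ} (J : Fin k ↪ Fin n) (y : Fin k → Bool)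
    (w : Fin (n - k + 1)) :
    #{x : Fin n → Bool | coreInput J x = (y, w)} = (n - k).choose w := by
  have hc : Fintype.card {i // i ∉ Set.range J} = n - k := by
    rw [Fintype.card_subtype_compl, Fintype.card_fin]
    congr 1
    rw [← Fintype.card_congr (Equiv.ofInjective J J.injective), Fintype.card_fin]
  have hw := card_filter_eq_true_eq {i // i ∉ Set.range J} w
  rw [hc] at hw
  rw [← hw]
  have hJ : ∀ i ∈ Set.range J, ∃ j, J j = i := fun i hi => hi
  choose g hg using hJ
  refine Finset.card_nbij' (fun x (i : {i // i ∉ Set.range J}) => x i.1)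
    (fun z i => if h : i ∈ Set.range J then y (g i h) else z ⟨i, h⟩) ?_ ?_ ?_ ?_
  · intro x hx
    simp only [Finset.coe_filter, Finset.mem_univ, true_and, Set.mem_ofPred_eq, coreInput,
      Prod.mk.injEq, Fin.ext_iff] at hx ⊢
    rw [← hx.2, outsideWt]
    refine Finset.card_bij (fun i _ => i.1) ?_ ?_ ?_
    · intro i hi
      simpa using ⟨by simpa using i.2, by simpa using hi⟩
    · intro i _ j _ h
      exact Subtype.ext h
    · intro i hi
      simp only [Finset.mem_filter, Finset.mem_univ, true_and] at hi
      exact ⟨⟨i, hi.1⟩, by simpa using hi.2, rfl⟩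
  · intro z hz
    simp only [Finset.coe_filter, Finset.mem_univ, true_and, Set.mem_ofPred_eq, coreInput,
      Prod.mk.injEq, Fin.ext_iff] at hz ⊢
    refine ⟨funext fun j => ?_, ?_⟩
    · have hj : J j ∈ Set.range J := ⟨j, rfl⟩
      rw [dif_pos hj]
      congr 1
      exact J.injective (hg _ hj)
    · rw [← hz, outsideWt]
      symm
      refine Finset.card_bij (fun i _ => i.1) ?_ ?_ ?_
      · intro i hi
        simp only [Finset.mem_filter, Finset.mem_univ, true_and] at hi ⊢
        exact ⟨i.2, by rw [dif_neg i.2]; exact hi⟩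
      · intro i _ j _ h
        exact Subtype.ext h
      · intro i hi
        simp only [Finset.mem_filter, Finset.mem_univ, true_and] at hi
        refine ⟨⟨i, hi.1⟩, ?_, rfl⟩
        have := hi.2
        rw [dif_neg hi.1] at this
        simpa using this
  · intro x hx
    simp only [Finset.coe_filter, Finset.mem_univ, true_and, Set.mem_ofPred_eq, coreInput,
      Prod.mk.injEq] at hx
    funext i
    dsimp only
    split_ifs with h
    · rw [← hx.1]
      exact congrArg x (hg i h)
    · rfl
  · intro z _
    funext i
    dsimp only
    rw [dif_neg i.2]

lemma map_coreInput_uniform {n k : ℕ} (J : Fin k ↪ Fin n) :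
    (PMF.uniformOfFintype (Fin n → Bool)).map (coreInput J) = coreDist k n := by
  have hk : k ≤ n := by simpa using Fintype.card_le_of_embedding J
  ext ⟨y, w⟩
  rw [← ENNReal.toReal_eq_toReal_iff' (PMF.apply_ne_top _ _) (PMF.apply_ne_top _ _)]
  have h1 : ((PMF.uniformOfFintype (Fin n → Bool)).map (coreInput J) (y, w)).toReal =
      ((n - k).choose w : ℝ) / 2 ^ n := by
    classical
    rw [PMF.map, PMF.toReal_uniformOfFintype_bind_apply, Fintype.expect_eq_sum_div_card,
      ← card_filter_coreInput_eq J y w, Finset.card_filter, Nat.cast_sum]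
    congr 1
    · refine Finset.sum_congr rfl fun x _ => ?_
      simp only [Function.comp_apply, PMF.pure_apply, eq_comm (a := (y, w))]
      split_ifs <;> simp
    · simp
  have h2 : (coreDist k n (y, w)).toReal = ((n - k).choose w : ℝ) / 2 ^ n := by
    rw [coreDist, PMF.toReal_bind_apply, Finset.sum_eq_single y,
      PMF.toReal_bind_apply, Finset.sum_eq_single w]
    · rw [toReal_binomialHalf, PMF.pure_apply_self, PMF.uniformOfFintype_apply]
      have : (2 : ℝ) ^ n = 2 ^ k * 2 ^ (n - k) := by rw [← pow_add, Nat.add_sub_cancel' hk]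
      rw [this]
      simp
      field_simp
    · intro v _ hv
      rw [PMF.pure_apply_of_ne _ _ (by simpa using hv.symm)]
      simp
    · simp
    · intro z _ hz
      rw [PMF.toReal_bind_apply, Finset.sum_eq_zero, mul_zero]
      intro v _
      rw [PMF.pure_apply_of_ne _ _ (by simp [hz.symm])]
      simp
    · simp
  rw [h1, h2]

end Reduction

/-! ### Deterministic conditions for feasibility: signed sums of part sizes -/

section Feasibility

open Finset

/-- The number of elements of the part labelled `a`. -/
def load {n r : ℕ} (P : Fin n → Fin r) (a : Fin r) : ℕ :=
  #{i | P i = a}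

lemma load_eq_sum {n r : ℕ} (P : Fin n → Fin r) (a : Fin r) :
    (load P a : ℤ) = ∑ i, if P i = a then 1 else 0 := by
  rw [load, Finset.card_filter]
  push_cast
  rfl

lemma sum_mul_load {n r : ℕ} (P : Fin n → Fin r) (s : Finset (Fin r)) (g : Fin r → ℤ) :
    ∑ a ∈ s, g a * load P a = ∑ i, if P i ∈ s then g (P i) else 0 := by
  simp_rw [load_eq_sum, Finset.mul_sum]
  rw [Finset.sum_comm]
  simp

lemma sum_load {n r : ℕ} (P : Fin n → Fin r) : ∑ a, (load P a : ℤ) = n := by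
  simpa using sum_mul_load P univ fun _ => 1

/-- A weight is feasible as soon as some signed sum of the part sizes comes close to it. -/
lemma feasibleInputs_nonempty_of_signs {n r : ℕ} (P : Fin n → Fin r) (W : Fin r) (w : ℕ)
    (ε : Fin r → ℤ) (hε : ∀ a, ε a = 1 ∨ ε a = -1)
    (h : |2 * (w : ℤ) - n - ∑ a ∈ univ.erase W, ε a * load P a| ≤ max 1 (load P W : ℤ)) :
    (feasibleInputs P W w).Nonempty := by
  -- `A` collects the parts set to one; the workspace must supply the missing `w - #A` ones.
  set A : Finset (Fin n) := {i | P i ≠ W ∧ ε (P i) = 1} with hA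
  have hsum : ∑ a ∈ univ.erase W, ε a * load P a + n = 2 * #A + load P W := by
    rw [sum_mul_load, load_eq_sum, hA, Finset.card_filter]
    have : (n : ℤ) = ∑ i : Fin n, 1 := by simp
    rw [this]
    push_cast
    rw [Finset.mul_sum, ← Finset.sum_add_distrib, ← Finset.sum_add_distrib]
    refine Finset.sum_congr rfl fun i _ => ?_
    by_cases h2 : P i = W
    · simp [h2]
    · rcases hε (P i) with h1 | h1 <;> simp [h1, h2]
  have hr : 2 * (w : ℤ) - n - ∑ a ∈ univ.erase W, ε a * load P a
      = 2 * (w - #A) - load P W := by linarith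
  rw [hr, abs_le] at h
  -- For an empty workspace the error `2 * (w - #A)` is even, so an error of at most 1 is zero.
  have hAw : #A ≤ w ∧ w - #A ≤ load P W := by
    rcases le_total (1 : ℤ) (load P W) with h1 | h1
    · rw [max_eq_right h1] at h
      omega
    · rw [max_eq_left h1] at h
      omega
  obtain ⟨S, hS, hSc⟩ := Finset.exists_subset_card_eq hAw.2
  have hSW : ∀ i ∈ S, P i = W := fun i hi => by simpa using hS hi
  refine ⟨fun i => decide (i ∈ A ∪ S), ?_⟩
  simp only [feasibleInputs, Finset.mem_filter, Finset.mem_univ, true_and]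
  constructor
  · have hd : Disjoint A S := Finset.disjoint_left.2 fun i hi hi' => by
      simp only [hA, Finset.mem_filter] at hi
      exact hi.2.1 (hSW i hi')
    have : hammingWt (fun i => decide (i ∈ A ∪ S)) = #(A ∪ S) := by
      rw [hammingWt]
      congr 1
      ext i
      simp
    rw [this, Finset.card_union_of_disjoint hd, hSc]
    omega
  · intro a ha
    rcases hε a with h1 | h1
    · right
      intro i hi
      have : i ∈ A := by simp [hA, hi, ha, h1]
      simp [this]
    · left
      intro i hi
      have h2 : i ∉ A := by simp [hA, hi, h1]
      have h3 : i ∉ S := fun h => ha (hi.symm.trans (hSW i h))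
      simp [h2, h3]

/-- Greedy balancing: adding or subtracting the `d i` in turn brings `T` close to zero. -/
lemma exists_signs_abs_sub_sum_le {ι : Type*} [DecidableEq ι] (I : Finset ι) (d : ι → ℤ) (B : ℤ)
    (hB : ∀ i ∈ I, |d i| ≤ B) (T : ℤ) :
    ∃ ε : ι → ℤ, (∀ i, ε i = 1 ∨ ε i = -1) ∧
      |T - ∑ i ∈ I, ε i * d i| ≤ max B (|T| - ∑ i ∈ I, |d i|) := by
  induction I using Finset.induction_on generalizing T with
  | empty => exact ⟨fun _ => 1, fun _ => Or.inl rfl, by simp⟩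
  | insert j I hj ih =>
    have hj' := hB j (Finset.mem_insert_self _ _)
    -- Choosing the sign that moves towards zero gives `||T| - |d j||`: either `|T|` drops by `|d
    -- j|`, or the result is at most `B`.
    obtain ⟨s, hs, hT⟩ : ∃ s : ℤ, (s = 1 ∨ s = -1) ∧ |T - s * d j| ≤ max B (|T| - |d j|) := by
      have : ∃ s : ℤ, (s = 1 ∨ s = -1) ∧ |T - s * d j| = |(|T| - |d j|)| := by
        rcases abs_cases T with ⟨h1, -⟩ | ⟨h1, -⟩ <;> rcases abs_cases (d j) with ⟨h2, -⟩ | ⟨h2, -⟩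
        · exact ⟨1, Or.inl rfl, by rw [h1, h2, one_mul]⟩
        · exact ⟨-1, Or.inr rfl, by rw [h1, h2]; ring_nf⟩
        · refine ⟨-1, Or.inr rfl, ?_⟩
          rw [h1, h2, ← abs_neg]
          ring_nf
        · refine ⟨1, Or.inl rfl, ?_⟩
          rw [h1, h2, ← abs_neg]
          ring_nf
      obtain ⟨s, hs, h⟩ := this
      have hle : |(|T| - |d j|)| ≤ max B (|T| - |d j|) := by
        rcases abs_cases (|T| - |d j|) with ⟨h1, -⟩ | ⟨h1, -⟩
        · rw [h1]
          exact le_max_right _ _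
        · rw [h1]
          exact le_max_of_le_left (by linarith [abs_nonneg T])
      exact ⟨s, hs, h.trans_le hle⟩
    obtain ⟨ε, hε, h⟩ := ih (fun i hi => hB i (Finset.mem_insert_of_mem hi)) (T - s * d j)
    refine ⟨Function.update ε j s, fun i => ?_, ?_⟩
    · by_cases hi : i = j
      · subst hi
        simpa using hs
      · simpa [hi] using hε i
    · rw [Finset.sum_insert hj, Finset.sum_insert hj, Function.update_self,
        Finset.sum_congr rfl (g := fun i => ε i * d i) fun i hi => by
          rw [Function.update_of_ne (ne_of_mem_of_not_mem hi hj)], ← sub_sub]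
      refine h.trans (max_le (le_max_left _ _) ?_)
      have h0 : 0 ≤ ∑ i ∈ I, |d i| := Finset.sum_nonneg fun i _ => abs_nonneg _
      rcases le_total B (|T| - |d j|) with h1 | h1
      · rw [max_eq_right h1] at hT
        exact le_max_of_le_right (by linarith [hT])
      · rw [max_eq_left h1] at hT
        exact le_max_of_le_left (by linarith [hT])

lemma feasibleInputs_nonempty_of_load_le_one {n r : ℕ} (P : Fin n → Fin r) (W : Fin r) {w : ℕ}
    (hw : w ≤ n) (h : ∀ a, load P a ≤ 1) : (feasibleInputs P W w).Nonempty := by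
  obtain ⟨ε, hε, hle⟩ := exists_signs_abs_sub_sum_le (univ.erase W) (fun a => (load P a : ℤ)) 1
    (fun a _ => by simpa using h a) (2 * (w : ℤ) - n)
  refine feasibleInputs_nonempty_of_signs P W w ε hε (hle.trans ?_)
  refine max_le (le_max_left _ _) (le_max_of_le_right ?_)
  have h1 := Finset.sum_erase_add univ (fun a => (load P a : ℤ)) (Finset.mem_univ W)
  rw [sum_load] at h1
  simp only [Nat.abs_cast]
  have : |2 * (w : ℤ) - n| ≤ n := by
    rw [abs_le]
    omega
  linarith

/-- The difference of the sizes of the two parts of the `i`-th pair. -/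
def pairDiff {n r h : ℕ} (e : Option (Fin h × Bool) ≃ Fin r) (P : Fin n → Fin r) (i : Fin h) : ℤ :=
  load P (e (some (i, true))) - load P (e (some (i, false)))

lemma sum_erase_eq_sum_pairs {r h : ℕ} (e : Option (Fin h × Bool) ≃ Fin r) (f : Fin r → ℤ) :
    ∑ a ∈ univ.erase (e none), f a =
      ∑ i, (f (e (some (i, true))) + f (e (some (i, false)))) := by
  have h1 := Finset.sum_erase_add univ f (Finset.mem_univ (e none))
  rw [← e.sum_comp, Fintype.sum_option, add_comm, Fintype.sum_prod_type] at h1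
  rw [add_left_cancel h1]
  simp

/-- Pairs in `S` receive opposite signs and contribute differences; the other pairs receive equal
signs and contribute sums. -/
lemma feasibleInputs_nonempty_of_pair_signs {n r h : ℕ} (e : Option (Fin h × Bool) ≃ Fin r)
    (P : Fin n → Fin r) (w : ℕ) (ε : Fin h → ℤ) (hε : ∀ i, ε i = 1 ∨ ε i = -1)
    (S : Finset (Fin h))
    (hle : |2 * (w : ℤ) - n - ∑ i ∈ Sᶜ, ε i * (load P (e (some (i, true))) +
      load P (e (some (i, false)))) - ∑ i ∈ S, ε i * pairDiff e P i| ≤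
        max 1 (load P (e none) : ℤ)) :
    (feasibleInputs P (e none) w).Nonempty := by
  let δ : Option (Fin h × Bool) → ℤ := fun o =>
    o.elim 1 fun p => if p.1 ∈ S ∧ p.2 = false then -ε p.1 else ε p.1
  refine feasibleInputs_nonempty_of_signs P (e none) w (fun a => δ (e.symm a)) (fun a => ?_) ?_
  · rcases e.symm a with _ | p
    · exact Or.inl rfl
    · simp only [δ, Option.elim]
      rcases hε p.1 with h | h <;> split_ifs <;> simp [h]
  · refine le_trans (le_of_eq ?_) hle
    rw [sum_erase_eq_sum_pairs, ← Finset.sum_compl_add_sum S, sub_sub _ (∑ i ∈ Sᶜ, _)]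
    congr 3
    · refine Finset.sum_congr rfl fun i hi => ?_
      have : i ∉ S := by simpa using hi
      simp only [Equiv.symm_apply_apply, δ, Option.elim, this, false_and, if_false]
      ring
    · refine Finset.sum_congr rfl fun i hi => ?_
      simp only [Equiv.symm_apply_apply, δ, Option.elim, hi, true_and, pairDiff]
      simp
      ring

/-- The regime of few, large parts: every greedy step, hence the final error, fits in the workspace.
-/
lemma feasibleInputs_nonempty_of_pairDiff_le {n r h : ℕ} (e : Option (Fin h × Bool) ≃ Fin r)
    (P : Fin n → Fin r) (w : ℕ) (hD : ∀ i, |pairDiff e P i| ≤ load P (e none))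
    (hT : |2 * (w : ℤ) - n| ≤ load P (e none) + ∑ i, |pairDiff e P i|) :
    (feasibleInputs P (e none) w).Nonempty := by
  obtain ⟨ε, hε, hle⟩ := exists_signs_abs_sub_sum_le univ (pairDiff e P) _
    (fun i _ => hD i) (2 * (w : ℤ) - n)
  refine feasibleInputs_nonempty_of_pair_signs e P w ε hε univ ?_
  rw [Finset.compl_univ, Finset.sum_empty, sub_zero]
  refine hle.trans (le_max_of_le_right (max_le le_rfl ?_))
  linarith

/-- The regime of many, small parts, where the workspace may be empty. Pair sums bring the error
down to `2 * L`, then `2 * L` reserved pairs of difference one bring it down to 1. The reserved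
pairs have total size at most `4 * L ^ 2` and the workspace at most `L`, which `hT` allows for. -/
lemma feasibleInputs_nonempty_of_load_le {n r h : ℕ} (e : Option (Fin h × Bool) ≃ Fin r)
    (P : Fin n → Fin r) (w L : ℕ) (hL : ∀ a, load P a ≤ L)
    (hD : 2 * L ≤ #{i | |pairDiff e P i| = 1})
    (hT : |2 * (w : ℤ) - n| + L + 4 * L ^ 2 ≤ n) :
    (feasibleInputs P (e none) w).Nonempty := by
  obtain ⟨S, hS, hSc⟩ := Finset.exists_subset_card_eq hD
  have hS1 : ∀ i ∈ S, |pairDiff e P i| = 1 := fun i hi => by simpa using hS hi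
  set N : Fin h → ℤ := fun i => load P (e (some (i, true))) + load P (e (some (i, false))) with hN
  have hN0 : ∀ i, 0 ≤ N i := fun i => by positivity
  have hNL : ∀ i, N i ≤ 2 * L := fun i => by
    have h1 := hL (e (some (i, true)))
    have h2 := hL (e (some (i, false)))
    simp only [hN]
    omega
  obtain ⟨ε₁, hε₁, h₁⟩ := exists_signs_abs_sub_sum_le Sᶜ N (2 * L)
    (fun i _ => by rw [abs_of_nonneg (hN0 i)]; exact hNL i) (2 * (w : ℤ) - n)
  obtain ⟨ε₂, hε₂, h₂⟩ := exists_signs_abs_sub_sum_le S (pairDiff e P) 1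
    (fun i hi => (hS1 i hi).le) (2 * (w : ℤ) - n - ∑ i ∈ Sᶜ, ε₁ i * N i)
  refine feasibleInputs_nonempty_of_pair_signs e P w (fun i => if i ∈ S then ε₂ i else ε₁ i)
    (fun i => by split_ifs; exacts [hε₂ i, hε₁ i]) S ?_
  rw [Finset.sum_congr (s₂ := Sᶜ) (g := fun i => ε₁ i * N i) rfl fun i hi => by
      rw [if_neg (by simpa using hi)],
    Finset.sum_congr (s₂ := S) (g := fun i => ε₂ i * pairDiff e P i) rfl fun i hi => by
      rw [if_pos hi]]
  refine h₂.trans (le_max_of_le_left (max_le le_rfl ?_))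
  rw [Finset.sum_congr rfl hS1, Finset.sum_const, hSc]
  have hsum : ∑ i ∈ Sᶜ, N i + ∑ i ∈ S, N i + load P (e none) = n := by
    rw [Finset.sum_compl_add_sum, ← sum_load P,
      ← Finset.sum_erase_add univ (fun a => (load P a : ℤ)) (Finset.mem_univ (e none)),
      sum_erase_eq_sum_pairs]
  have hSN : ∑ i ∈ S, N i ≤ 2 * L * (2 * L) := by
    refine (Finset.sum_le_card_nsmul S N (2 * L) fun i _ => hNL i).trans_eq ?_
    rw [hSc]
    simp
  have hW := hL (e none)
  rw [Finset.sum_congr rfl fun i _ => abs_of_nonneg (hN0 i)] at h₁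
  have h₃ := h₁.trans (max_le (c := 2 * (L : ℤ)) le_rfl (by zify at hW; nlinarith))
  simp only [nsmul_eq_mul, mul_one]
  push_cast
  linarith

/-- The role of odd `r`: an even number of parts is left besides the workspace. -/
lemma exists_pairing {r : ℕ} (hr : Odd r) (W : Fin r) :
    ∃ (h : ℕ) (e : Option (Fin h × Bool) ≃ Fin r), r = 2 * h + 1 ∧ e none = W := by
  obtain ⟨h, rfl⟩ := hr
  have hc : Fintype.card (Option (Fin h × Bool)) = Fintype.card (Fin (2 * h + 1)) := by
    simp [mul_comm]
  let e := Fintype.equivOfCardEq hc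
  exact ⟨h, e.trans (Equiv.swap (e none) W), rfl, by simp⟩

end Feasibility

/-! ### Concentration inequalities for random partitions -/

section Probability

open Finset
open scoped BigOperators

open Classical in
/-- The probability of an event under the uniform law on a finite type. -/
noncomputable def prob {α : Type*} [Fintype α] (E : α → Prop) : ℝ :=
  𝔼 a, if E a then 1 else 0

lemma prob_mono {α : Type*} [Fintype α] {E F : α → Prop} (h : ∀ a, E a → F a) :
    prob E ≤ prob F := by
  refine Finset.expect_le_expect fun a _ => ?_
  by_cases ha : E a
  · simp [ha, h a ha]
  · simp only [ha, if_false]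
    split_ifs <;> norm_num

lemma prob_or_le {α : Type*} [Fintype α] (E F : α → Prop) :
    prob (fun a => E a ∨ F a) ≤ prob E + prob F := by
  unfold prob
  rw [← Finset.expect_add_distrib]
  refine Finset.expect_le_expect fun a _ => ?_
  by_cases h1 : E a <;> by_cases h2 : F a <;> simp [h1, h2]

lemma prob_exists_le {α ι : Type*} [Fintype α] [Fintype ι] (E : ι → α → Prop) :
    prob (fun a => ∃ i, E i a) ≤ ∑ i, prob (E i) := by
  classical
  unfold prob
  rw [← Finset.expect_sum_comm]
  refine Finset.expect_le_expect fun a _ => ?_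
  have h0 : ∀ i ∈ univ, (0 : ℝ) ≤ if E i a then 1 else 0 := fun i _ => by split_ifs <;> norm_num
  split_ifs with h
  · obtain ⟨i, hi⟩ := h
    have := Finset.single_le_sum h0 (Finset.mem_univ i)
    simpa [hi] using this
  · exact Finset.sum_nonneg h0

lemma prob_le_expect_div {α : Type*} [Fintype α] {E : α → Prop} {f : α → ℝ} {c : ℝ} (hc : 0 < c)
    (hf : ∀ a, 0 ≤ f a) (h : ∀ a, E a → c ≤ f a) : prob E ≤ (𝔼 a, f a) / c := by
  rw [le_div_iff₀ hc, prob, Finset.expect_mul]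
  refine Finset.expect_le_expect fun a _ => ?_
  split_ifs with ha
  · simpa using h a ha
  · simpa using hf a

lemma infeasibleProb_le_prob {n r : ℕ} (W : Fin r) (w : ℕ) {E : (Fin n → Fin r) → Prop}
    (h : ∀ P, ¬E P → (feasibleInputs P W w).Nonempty) : infeasibleProb n W w ≤ prob E := by
  refine Finset.expect_le_expect fun P _ => ?_
  by_cases hP : E P
  · simp only [hP, if_true]
    split_ifs <;> norm_num
  · simp [hP, h P hP]

section Product

variable {κ : Type*} [Fintype κ]

lemma expect_prod_apply (n : ℕ) (g : κ → ℝ) :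
    𝔼 P : Fin n → κ, ∏ i, g (P i) = (𝔼 a, g a) ^ n := by
  rw [Finset.expect_pow, Fintype.piFinset_univ]

lemma expect_cons {n : ℕ} (f : (Fin (n + 1) → κ) → ℝ) :
    𝔼 P, f P = 𝔼 a, 𝔼 Q : Fin n → κ, f (Fin.cons a Q) := by
  rw [← Finset.expect_product']
  symm
  exact Fintype.expect_equiv (Fin.consEquiv fun _ => κ) _ _ fun p => rfl

/-- Bounded differences: the exponential moment of the lower deviation. -/
lemma expect_exp_lower_deviation_le [Nonempty κ] {n : ℕ} (f : (Fin n → κ) → ℝ)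
    (hf : ∀ P j a, |f (Function.update P j a) - f P| ≤ 2) {t : ℝ} (ht0 : 0 ≤ t) (ht : t ≤ 1 / 2) :
    𝔼 P, Real.exp (t * ((𝔼 Q, f Q) - f P)) ≤ Real.exp (4 * n * t ^ 2) := by
  induction n with
  | zero =>
    have : ∀ P, f P = f default := fun P => congrArg f (Subsingleton.elim _ _)
    simp_rw [this]
    simp
  | succ n ih =>
    -- The mean given the first coordinate: the induction reveals one coordinate of the Doob
    -- martingale at a time.
    set g : κ → ℝ := fun a => 𝔼 Q, f (Fin.cons a Q) with hg
    have hmean : 𝔼 Q, f Q = 𝔼 a, g a := expect_cons f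
    have hgg : ∀ a b, |g b - g a| ≤ 2 := fun a b => by
      simp only [hg]
      rw [← Finset.expect_sub_distrib, abs_le]
      have h : ∀ Q : Fin n → κ, |f (Fin.cons b Q) - f (Fin.cons a Q)| ≤ 2 := fun Q => by
        have := hf (Fin.cons a Q) 0 b
        rwa [Fin.update_cons_zero] at this
      constructor
      · rw [← Fintype.expect_const (ι := Fin n → κ) (-2 : ℝ)]
        exact Finset.expect_le_expect fun Q _ => (abs_le.1 (h Q)).1
      · rw [← Fintype.expect_const (ι := Fin n → κ) (2 : ℝ)]
        exact Finset.expect_le_expect fun Q _ => (abs_le.1 (h Q)).2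
    set μ : ℝ := 𝔼 a, g a with hμ
    have hgμ : ∀ a, |μ - g a| ≤ 2 := fun a => by
      rw [hμ, ← Fintype.expect_const (ι := κ) (g a), ← Finset.expect_sub_distrib, abs_le]
      constructor
      · rw [← Fintype.expect_const (ι := κ) (-2 : ℝ)]
        exact Finset.expect_le_expect fun b _ => (abs_le.1 (hgg a b)).1
      · rw [← Fintype.expect_const (ι := κ) (2 : ℝ)]
        exact Finset.expect_le_expect fun b _ => (abs_le.1 (hgg a b)).2
    rw [hmean, expect_cons]
    -- As `t ≤ 1 / 2`, `|t * (μ - g a)| ≤ 1` and `exp y ≤ 1 + y + y ^ 2` applies; the linear term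
    -- later averages to zero.
    have hin : ∀ a, 𝔼 Q : Fin n → κ, Real.exp (t * (μ - f (Fin.cons a Q))) ≤
        (1 + t * (μ - g a) + 4 * t ^ 2) * Real.exp (4 * n * t ^ 2) := fun a => by
      have h1 := ih (fun Q => f (Fin.cons a Q)) fun P j b => by
        have := hf (Fin.cons a P) j.succ b
        rwa [← Fin.cons_update] at this
      have h2 : ∀ Q : Fin n → κ, Real.exp (t * (μ - f (Fin.cons a Q))) =
          Real.exp (t * (μ - g a)) * Real.exp (t * (g a - f (Fin.cons a Q))) := fun Q => by
        rw [← Real.exp_add]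
        ring_nf
      simp_rw [h2]
      rw [← Finset.mul_expect]
      have hle : |t * (μ - g a)| ≤ 2 * t := by
        rw [abs_mul, abs_of_nonneg ht0]
        nlinarith [hgμ a]
      have h3 := (abs_le.1 (Real.abs_exp_sub_one_sub_id_le (hle.trans (by linarith)))).2
      have h4 : (t * (μ - g a)) ^ 2 ≤ 4 * t ^ 2 := by
        rw [← sq_abs]
        nlinarith [abs_nonneg (t * (μ - g a))]
      exact mul_le_mul (by linarith) h1
        (Finset.expect_nonneg fun Q _ => (Real.exp_pos _).le) (by linarith [Real.exp_pos (t * (μ - g a))])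
    refine (Finset.expect_le_expect fun a _ => hin a).trans ?_
    rw [← Finset.expect_mul, Finset.expect_add_distrib, Finset.expect_add_distrib,
      ← Finset.mul_expect, Finset.expect_sub_distrib, Fintype.expect_const, Fintype.expect_const,
      Fintype.expect_const, ← hμ, sub_self, mul_zero, add_zero]
    have h5 : 1 + 4 * t ^ 2 ≤ Real.exp (4 * t ^ 2) := by linarith [Real.add_one_le_exp (4 * t ^ 2)]
    refine (mul_le_mul_of_nonneg_right h5 (Real.exp_pos _).le).trans_eq ?_
    rw [← Real.exp_add]
    push_cast
    ring_nf

/-- Bounded differences: a function of independent coordinates, each of influence at most `2`, is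
rarely far below its mean. -/
lemma prob_lower_deviation_le [Nonempty κ] {n : ℕ} (hn : 0 < n) (f : (Fin n → κ) → ℝ)
    (hf : ∀ P j a, |f (Function.update P j a) - f P| ≤ 2) {s : ℝ} (hs0 : 0 ≤ s) (hs : s ≤ 4 * n) :
    prob (fun P => f P ≤ (𝔼 Q, f Q) - s) ≤ Real.exp (-(s ^ 2 / (16 * n))) := by
  have hn' : (0 : ℝ) < n := by exact_mod_cast hn
  -- The minimiser of `4 * n * t ^ 2 - t * s`; `s ≤ 4 * n` keeps it at most `1 / 2`.
  set t : ℝ := s / (8 * n) with ht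
  have ht0 : 0 ≤ t := by positivity
  have ht1 : t ≤ 1 / 2 := by
    rw [ht, div_le_iff₀ (by positivity)]
    linarith
  refine (prob_le_expect_div (c := Real.exp (t * s)) (Real.exp_pos _)
    (f := fun P => Real.exp (t * ((𝔼 Q, f Q) - f P))) (fun P => (Real.exp_pos _).le)
    fun P hP => Real.exp_le_exp.2 (mul_le_mul_of_nonneg_left (by linarith) ht0)).trans ?_
  rw [div_le_iff₀ (Real.exp_pos _), ← Real.exp_add]
  refine (expect_exp_lower_deviation_le f hf ht0 ht1).trans_eq ?_
  rw [ht]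
  congr 1
  field_simp
  ring

end Product

section Loads

lemma load_cons {n r : ℕ} (a : Fin r) (Q : Fin n → Fin r) (b : Fin r) :
    (load (Fin.cons a Q : Fin (n + 1) → Fin r) b : ℤ) = (if a = b then 1 else 0) + load Q b := by
  rw [load_eq_sum, load_eq_sum, Fin.sum_univ_succ]
  simp only [Fin.cons_zero, Fin.cons_succ]

lemma load_update {n r : ℕ} (P : Fin n → Fin r) (j : Fin n) (a b : Fin r) :
    (load (Function.update P j a) b : ℤ) - load P b =
      (if a = b then 1 else 0) - if P j = b then 1 else 0 := by
  rw [load_eq_sum, load_eq_sum, ← Finset.add_sum_erase _ _ (Finset.mem_univ j),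
    ← Finset.add_sum_erase univ (fun i => if P i = b then (1 : ℤ) else 0) (Finset.mem_univ j),
    Function.update_self, Finset.sum_congr (s₁ := univ.erase j) rfl fun i hi => by
      rw [Function.update_of_ne (Finset.ne_of_mem_erase hi)]]
  ring

/-- A part size is a sum of `n` independent indicators of mean `1 / r`, so its exponential moment
factorises. -/
lemma expect_exp_load_le {n r : ℕ} [NeZero r] (a : Fin r) (t : ℝ) :
    𝔼 P : Fin n → Fin r, Real.exp (t * load P a) ≤ Real.exp ((Real.exp t - 1) * (n / r)) := by
  have hr : (0 : ℝ) < r := by exact_mod_cast NeZero.pos r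
  have h1 : ∀ P : Fin n → Fin r, Real.exp (t * load P a) =
      ∏ i, if P i = a then Real.exp t else 1 := fun P => by
    rw [Finset.prod_ite, Finset.prod_const, Finset.prod_const_one, mul_one, ← Real.exp_nat_mul,
      mul_comm]
    rfl
  simp_rw [h1]
  rw [expect_prod_apply n (fun b => if b = a then Real.exp t else 1)]
  have h2 : 𝔼 b : Fin r, (if b = a then Real.exp t else 1) = 1 + (Real.exp t - 1) / r := by
    have : ∀ b : Fin r, (if b = a then Real.exp t else 1) =
        1 + if b = a then Real.exp t - 1 else 0 := fun b => by split_ifs <;> ring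
    simp_rw [this]
    rw [Finset.expect_add_distrib, Fintype.expect_const, Fintype.expect_eq_sum_div_card]
    simp
  rw [h2]
  have h3 : 0 ≤ 1 + (Real.exp t - 1) / r := by
    rw [← h2]
    exact Finset.expect_nonneg fun b _ => by split_ifs <;> positivity
  calc (1 + (Real.exp t - 1) / r) ^ n ≤ Real.exp ((Real.exp t - 1) / r) ^ n :=
        pow_le_pow_left₀ h3 (by linarith [Real.add_one_le_exp ((Real.exp t - 1) / r)]) n
    _ = _ := by
        rw [← Real.exp_nat_mul]
        ring_nf

/-- Chernoff bound for the size of one part. -/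
lemma prob_load_deviation_le {n r : ℕ} [NeZero r] (a : Fin r) :
    prob (fun P : Fin n → Fin r => (n / r : ℝ) / 4 < |(load P a : ℝ) - n / r|) ≤
      2 * Real.exp (-((n / r : ℝ) / 64)) := by
  set x : ℝ := n / r with hx
  have hx0 : 0 ≤ x := by positivity
  have hside : ∀ s : ℝ, s = 1 ∨ s = -1 →
      prob (fun P : Fin n → Fin r => x / 4 < s * ((load P a : ℝ) - x)) ≤
        Real.exp (-(x / 64)) := by
    intro s hs
    have hs8 : |s / 8| ≤ 1 := by rcases hs with rfl | rfl <;> norm_num [abs_le]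
    have hs2 : (s / 8) ^ 2 = 1 / 64 := by rcases hs with rfl | rfl <;> norm_num
    -- Tilting by `1 / 8` gains `x / 32` from the deviation `x / 4` and loses `x / 64` to the
    -- quadratic term.
    refine (prob_le_expect_div (c := Real.exp ((s / 8) * x + x / 32)) (Real.exp_pos _)
      (f := fun P => Real.exp ((s / 8) * load P a)) (fun P => (Real.exp_pos _).le)
      fun P hP => Real.exp_le_exp.2 (by linarith)).trans ?_
    rw [div_le_iff₀ (Real.exp_pos _), ← Real.exp_add]
    refine (expect_exp_load_le a (s / 8)).trans (Real.exp_le_exp.2 ?_)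
    rw [← hx]
    have := (abs_le.1 (Real.abs_exp_sub_one_sub_id_le hs8)).2
    rw [hs2] at this
    nlinarith
  calc _ ≤ prob (fun P : Fin n → Fin r => x / 4 < 1 * ((load P a : ℝ) - x) ∨
          x / 4 < -1 * ((load P a : ℝ) - x)) := prob_mono fun P hP => by
        rcases lt_abs.1 hP with h | h
        · left; linarith
        · right; linarith
    _ ≤ _ := (prob_or_le _ _).trans (by linarith [hside 1 (Or.inl rfl), hside (-1) (Or.inr rfl)])

/-- A part is rarely much larger than average. -/
lemma prob_exists_load_ge_le {n r : ℕ} [NeZero r] {ℓ : ℝ} (hℓ : 0 < ℓ) :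
    prob (fun P : Fin n → Fin r => ∃ a, ℓ ≤ load P a) ≤
      2 * n * Real.exp (2 * (n / r)) / (Real.exp ℓ - 1) := by
  have hr : (0 : ℝ) < r := by exact_mod_cast NeZero.pos r
  have hpos : 0 < Real.exp ℓ - 1 := by linarith [Real.add_one_lt_exp hℓ.ne']
  have key : ∀ a : Fin r, prob (fun P : Fin n → Fin r => ℓ ≤ load P a) ≤
      2 * (n / r) * Real.exp (2 * (n / r)) / (Real.exp ℓ - 1) := fun a => by
    -- Subtracting 1 makes the test function vanish on empty parts: its mean is of order `n / r`, so
    -- the union over `r` parts costs a factor `n`, however large `r` is.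
    refine (prob_le_expect_div hpos (f := fun P => Real.exp (1 * load P a) - 1) (fun P => ?_)
      fun P hP => ?_).trans (div_le_div_of_nonneg_right ?_ hpos.le)
    · have : (0 : ℝ) ≤ 1 * load P a := by positivity
      linarith [Real.one_le_exp this]
    · rw [one_mul]
      linarith [Real.exp_le_exp.2 hP]
    · rw [Finset.expect_sub_distrib, Fintype.expect_const]
      have hx : (0 : ℝ) ≤ n / r := by positivity
      have h1 : Real.exp ((Real.exp 1 - 1) * (n / r)) ≤ Real.exp (2 * (n / r)) :=
        Real.exp_le_exp.2 (mul_le_mul_of_nonneg_right (by linarith [Real.exp_one_lt_d9]) hx)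
      have h2 := Real.add_one_le_exp (-(2 * ((n : ℝ) / r)))
      have h3 : Real.exp (-(2 * ((n : ℝ) / r))) * Real.exp (2 * (n / r)) = 1 := by
        rw [← Real.exp_add]
        simp
      have := expect_exp_load_le (n := n) a 1
      nlinarith [Real.exp_pos (2 * ((n : ℝ) / r))]
  refine (prob_exists_le _).trans ((Finset.sum_le_sum fun a _ => key a).trans_eq ?_)
  rw [Finset.sum_const, Finset.card_univ, Fintype.card_fin, nsmul_eq_mul]
  field_simp

/-- Birthday bound: the injective fraction is at least `(1 - n / r) ^ n`, then Bernoulli's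
inequality; for `r < n` the bound exceeds 1. -/
lemma prob_not_injective_le {n r : ℕ} [NeZero r] :
    prob (fun P : Fin n → Fin r => ¬Function.Injective P) ≤ (n : ℝ) ^ 2 / r := by
  classical
  have hr : (0 : ℝ) < r := by exact_mod_cast NeZero.pos r
  rcases lt_or_ge r n with h | h
  · have h1 : prob (fun P : Fin n → Fin r => ¬Function.Injective P) ≤ 1 := by
      refine (Finset.expect_le_expect (g := fun _ => (1 : ℝ)) fun P _ => ?_).trans_eq
        (Fintype.expect_const 1)
      split_ifs <;> norm_num
    refine h1.trans ?_
    rw [le_div_iff₀ hr]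
    have : (r : ℝ) ≤ n := by exact_mod_cast h.le
    have h1 : (1 : ℝ) ≤ r := by exact_mod_cast NeZero.pos r
    nlinarith
  · have h1 : prob (fun P : Fin n → Fin r => ¬Function.Injective P) =
        1 - (r.descFactorial n : ℝ) / r ^ n := by
      have h2 : prob (fun P : Fin n → Fin r => ¬Function.Injective P) =
          1 - 𝔼 P : Fin n → Fin r, if Function.Injective P then (1 : ℝ) else 0 := by
        rw [prob, ← Fintype.expect_const (ι := Fin n → Fin r) (1 : ℝ),
          ← Finset.expect_sub_distrib]
        refine Finset.expect_congr rfl fun P _ => ?_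
        by_cases hP : Function.Injective P <;> simp [hP]
      have h3 : #{P : Fin n → Fin r | Function.Injective P} = r.descFactorial n := by
        rw [← Fintype.card_subtype,
          Fintype.card_congr (Equiv.subtypeInjectiveEquivEmbedding (Fin n) (Fin r)),
          Fintype.card_embedding_eq, Fintype.card_fin, Fintype.card_fin]
      rw [h2, Fintype.expect_eq_sum_div_card, ← h3, Finset.card_filter]
      simp
    rw [h1]
    have h2 : ((r : ℝ) - n) ^ n ≤ r.descFactorial n := by
      have := (Nat.pow_le_pow_left (show r - n ≤ r + 1 - n by omega) n).trans
        (Nat.pow_sub_le_descFactorial r n)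
      have h3 : (((r - n) ^ n : ℕ) : ℝ) ≤ r.descFactorial n := by exact_mod_cast this
      rwa [Nat.cast_pow, Nat.cast_sub h] at h3
    have h3 : 1 - (n : ℝ) ^ 2 / r ≤ ((r : ℝ) - n) ^ n / r ^ n := by
      rw [← div_pow, sub_div, div_self hr.ne', sub_eq_add_neg]
      have hle : (n : ℝ) / r ≤ 1 := by
        rw [div_le_one hr]
        exact_mod_cast h
      have := one_add_mul_le_pow (a := -((n : ℝ) / r)) (by linarith) n
      refine le_trans (le_of_eq ?_) this
      ring
    have h4 : ((r : ℝ) - n) ^ n / r ^ n ≤ (r.descFactorial n : ℝ) / r ^ n := by gcongr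
    linarith

end Loads

end Probability

/-! ### The difference of two part sizes as a lazy random walk -/

section Difference

open Finset
open scoped BigOperators

/-- The expectation of a function of the difference of the sizes of two parts. -/
noncomputable def diffExpect (n : ℕ) {r : ℕ} (u v : Fin r) (φ : ℤ → ℝ) : ℝ :=
  𝔼 P : Fin n → Fin r, φ ((load P u : ℤ) - load P v)

variable {n r : ℕ} {u v : Fin r}

lemma diffExpect_mono {φ ψ : ℤ → ℝ} (h : ∀ j, φ j ≤ ψ j) :
    diffExpect n u v φ ≤ diffExpect n u v ψ :=
  Finset.expect_le_expect fun _ _ => h _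

lemma diffExpect_add (φ ψ : ℤ → ℝ) :
    diffExpect n u v (fun j => φ j + ψ j) = diffExpect n u v φ + diffExpect n u v ψ :=
  Finset.expect_add_distrib ..

lemma diffExpect_sub (φ ψ : ℤ → ℝ) :
    diffExpect n u v (fun j => φ j - ψ j) = diffExpect n u v φ - diffExpect n u v ψ :=
  Finset.expect_sub_distrib ..

lemma diffExpect_const_mul (c : ℝ) (φ : ℤ → ℝ) :
    diffExpect n u v (fun j => c * φ j) = c * diffExpect n u v φ :=
  (Finset.mul_expect ..).symm

lemma diffExpect_sum {ι : Type*} (s : Finset ι) (φ : ι → ℤ → ℝ) :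
    diffExpect n u v (fun j => ∑ i ∈ s, φ i j) = ∑ i ∈ s, diffExpect n u v (φ i) :=
  Finset.expect_sum_comm ..

lemma diffExpect_const (c : ℝ) : diffExpect n u v (fun _ => c) = c := by
  have : NeZero r := ⟨u.pos.ne'⟩
  exact Fintype.expect_const c

lemma diffExpect_zero (φ : ℤ → ℝ) : diffExpect 0 u v φ = φ 0 := by
  simp [diffExpect, load]

/-- Adding an element is one step of a lazy random walk. -/
lemma diffExpect_succ (huv : u ≠ v) (φ : ℤ → ℝ) :
    diffExpect (n + 1) u v φ = diffExpect n u v fun j =>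
      φ j + (1 / r) * (φ (j + 1) + φ (j - 1) - 2 * φ j) := by
  have hr : (r : ℝ) ≠ 0 := by exact_mod_cast u.pos.ne'
  unfold diffExpect
  rw [expect_cons, Finset.expect_comm]
  refine Finset.expect_congr rfl fun Q _ => ?_
  simp_rw [load_cons]
  set j : ℤ := (load Q u : ℤ) - load Q v with hj
  have h : ∀ a : Fin r, φ ((if a = u then 1 else 0) + (load Q u : ℤ) -
      ((if a = v then 1 else 0) + load Q v)) =
      φ j + ((if a = u then φ (j + 1) - φ j else 0) + if a = v then φ (j - 1) - φ j else 0) := by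
    intro a
    by_cases h1 : a = u
    · have h2 : a ≠ v := fun h => huv (h1.symm.trans h)
      simp only [h1, huv, if_true, if_false, hj]
      ring_nf
    · by_cases h2 : a = v
      · simp only [h2, huv.symm, if_true, if_false, hj]
        ring_nf
      · simp [h1, h2, hj]
  simp_rw [h]
  rw [Fintype.expect_eq_sum_div_card, Finset.sum_add_distrib, Finset.sum_add_distrib,
    Finset.sum_ite_eq' univ u, Finset.sum_ite_eq' univ v]
  simp only [Finset.mem_univ, if_true, Finset.sum_const, Finset.card_univ, Fintype.card_fin,
    nsmul_eq_mul]
  field_simp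
  ring

/-- Cosines are eigenfunctions of the symmetric walk step, the sine terms cancelling. -/
lemma diffExpect_cos (huv : u ≠ v) (θ : ℝ) :
    diffExpect n u v (fun j => Real.cos (θ * j)) = (1 - 2 / r * (1 - Real.cos θ)) ^ n := by
  induction n with
  | zero => simp [diffExpect_zero]
  | succ n ih =>
    rw [diffExpect_succ huv, pow_succ', ← ih, ← diffExpect_const_mul]
    congr 1
    funext j
    push_cast
    rw [mul_add θ, mul_sub θ, mul_one, Real.cos_add, Real.cos_sub]
    ring

lemma diffExpect_sq (huv : u ≠ v) :
    diffExpect n u v (fun j => (j : ℝ) ^ 2) = 2 * (n / r) := by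
  induction n with
  | zero => simp [diffExpect_zero]
  | succ n ih =>
    have h : (fun j : ℤ => (j : ℝ) ^ 2 + 1 / r *
        (((j + 1 : ℤ) : ℝ) ^ 2 + ((j - 1 : ℤ) : ℝ) ^ 2 - 2 * (j : ℝ) ^ 2)) =
        fun j : ℤ => (j : ℝ) ^ 2 + 2 / r := by
      funext j
      push_cast
      ring
    rw [diffExpect_succ huv, h, diffExpect_add, diffExpect_const, ih]
    push_cast
    ring

/-- The probability that the difference of the sizes of two parts is `k`. -/
noncomputable def diffMass (n : ℕ) {r : ℕ} (u v : Fin r) (k : ℤ) : ℝ :=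
  diffExpect n u v fun j => if j = k then 1 else 0

lemma diffMass_succ (huv : u ≠ v) (k : ℤ) :
    diffMass (n + 1) u v k = diffMass n u v k +
      (1 / r) * (diffMass n u v (k - 1) + diffMass n u v (k + 1) - 2 * diffMass n u v k) := by
  unfold diffMass
  rw [diffExpect_succ huv, diffExpect_add, diffExpect_const_mul, diffExpect_sub, diffExpect_add,
    diffExpect_const_mul]
  simp only [eq_sub_iff_add_eq, sub_eq_iff_eq_add]

lemma diffMass_neg (huv : u ≠ v) (k : ℤ) : diffMass n u v (-k) = diffMass n u v k := by
  induction n generalizing k with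
  | zero => simp [diffMass, diffExpect_zero, eq_comm (a := (0 : ℤ))]
  | succ n ih =>
    rw [diffMass_succ huv, diffMass_succ huv, ih, ← ih (-k - 1), ← ih (-k + 1)]
    ring_nf

/-- The walk is lazy enough for a step to preserve unimodality: new decrements are combinations of
old ones with nonnegative coefficients, the critical one being `1 - 3 / r` at `k = 0`. -/
lemma diffMass_add_one_le (huv : u ≠ v) (hr : 3 ≤ r) {k : ℤ} (hk : 0 ≤ k) :
    diffMass n u v (k + 1) ≤ diffMass n u v k := by
  induction n generalizing k with
  | zero =>
    have : ¬(0 : ℤ) = k + 1 := by omega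
    simp only [diffMass, diffExpect_zero, this, if_false]
    split_ifs <;> norm_num
  | succ n ih =>
    have hp : (1 : ℝ) / r ≤ 1 / 3 := by
      apply one_div_le_one_div_of_le (by norm_num)
      exact_mod_cast hr
    have hp0 : (0 : ℝ) ≤ 1 / r := by positivity
    rw [diffMass_succ huv, diffMass_succ huv, add_sub_cancel_right]
    set p : ℝ := 1 / r
    have h1 := ih hk
    have h2 := ih (k := k + 1) (by omega)
    rcases hk.eq_or_lt with rfl | hk'
    · have h3 : diffMass n u v (0 - 1) = diffMass n u v (0 + 1) := by
        rw [← diffMass_neg huv]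
        norm_num
      rw [h3]
      nlinarith [mul_nonneg (by linarith : 0 ≤ 1 - 3 * p) (sub_nonneg.2 h1),
        mul_nonneg hp0 (sub_nonneg.2 h2)]
    · have h3 := ih (k := k - 1) (by omega)
      rw [sub_add_cancel] at h3
      nlinarith [mul_nonneg (by linarith : 0 ≤ 1 - 2 * p) (sub_nonneg.2 h1),
        mul_nonneg hp0 (sub_nonneg.2 h2), mul_nonneg hp0 (sub_nonneg.2 h3)]

lemma diffMass_antitone (huv : u ≠ v) (hr : 3 ≤ r) {k l : ℤ} (hk : 0 ≤ k) (hkl : k ≤ l) :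
    diffMass n u v l ≤ diffMass n u v k := by
  induction l, hkl using Int.leInduction with
  | base => exact le_rfl
  | succ l hl ih => exact (diffMass_add_one_le huv hr (hk.trans hl)).trans ih

lemma diffMass_le_of_odd (huv : u ≠ v) (hr : 3 ≤ r) {k : ℤ} (hk : Odd k) :
    diffMass n u v k ≤ diffMass n u v 1 := by
  have hk0 : k ≠ 0 := by
    rintro rfl
    exact absurd hk (by decide)
  rcases lt_or_gt_of_ne hk0 with h | h
  · rw [← diffMass_neg huv]
    exact diffMass_antitone huv hr (by norm_num) (by omega)
  · exact diffMass_antitone huv hr (by norm_num) (by omega)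

lemma one_sub_exp_neg_ge {y : ℝ} (hy : 0 ≤ y) : y / (1 + y) ≤ 1 - Real.exp (-y) := by
  have h1 := Real.add_one_le_exp y
  have h2 : Real.exp (-y) * Real.exp y = 1 := by rw [← Real.exp_add]; simp
  rw [div_le_iff₀ (by linarith)]
  nlinarith [Real.exp_pos (-y)]

/-- The first term on the left is the probability of an odd difference, read off from the cosine at
`π`; the second removes `|j| > m` by Chebyshev. At most `2 * m + 1` odd values remain, each no
likelier than 1 by unimodality. -/
lemma diffMass_one_ge (huv : u ≠ v) (hr : 3 ≤ r) (m : ℕ) :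
    (1 - (1 - 4 / r : ℝ) ^ n) / 2 - 2 * (n / r) / (m + 1 : ℝ) ^ 2 ≤
      (2 * m + 1) * diffMass n u v 1 := by
  have hm : (0 : ℝ) < (m + 1 : ℝ) ^ 2 := by positivity
  have h1 : diffExpect n u v (fun j => (1 / 2) * (1 - Real.cos (Real.pi * j)) -
      1 / (m + 1 : ℝ) ^ 2 * (j : ℝ) ^ 2) =
      (1 - (1 - 4 / r : ℝ) ^ n) / 2 - 2 * (n / r) / (m + 1 : ℝ) ^ 2 := by
    rw [diffExpect_sub, diffExpect_const_mul, diffExpect_const_mul, diffExpect_sub,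
      diffExpect_const, diffExpect_cos huv, diffExpect_sq huv, Real.cos_pi]
    ring
  rw [← h1]
  set S : Finset ℤ := (Finset.Icc (-(m : ℤ)) m).filter Odd with hS
  have h2 : ∑ k ∈ S, diffMass n u v k ≤ (2 * m + 1) * diffMass n u v 1 := by
    refine (Finset.sum_le_card_nsmul S _ (diffMass n u v 1) fun k hk => diffMass_le_of_odd huv hr
      (Finset.mem_filter.1 hk).2).trans ?_
    rw [nsmul_eq_mul]
    refine mul_le_mul_of_nonneg_right ?_
      (Finset.expect_nonneg fun P _ => by split_ifs <;> norm_num)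
    have : #S ≤ 2 * m + 1 := by
      refine (Finset.card_filter_le _ _).trans ?_
      rw [Int.card_Icc]
      omega
    exact_mod_cast this
  refine le_trans ?_ h2
  unfold diffMass
  rw [← diffExpect_sum]
  refine diffExpect_mono fun j => ?_
  rw [Finset.sum_ite_eq, mul_comm Real.pi, Real.cos_int_mul_pi]
  rcases Int.even_or_odd j with hj | hj
  · rw [hj.neg_one_zpow]
    have : 0 ≤ 1 / (m + 1 : ℝ) ^ 2 * (j : ℝ) ^ 2 := by positivity
    split_ifs <;> linarith
  · rw [hj.neg_one_zpow]
    have : 0 ≤ 1 / (m + 1 : ℝ) ^ 2 * (j : ℝ) ^ 2 := by positivity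
    split_ifs with hjS
    · linarith
    · have hjm : (m : ℤ) + 1 ≤ |j| := by
        by_contra hlt
        push Not at hlt
        exact hjS (Finset.mem_filter.2 ⟨Finset.mem_Icc.2 (abs_le.1 (by omega)), hj⟩)
      have hjm' : (m + 1 : ℝ) ≤ |(j : ℝ)| := by exact_mod_cast hjm
      have : (m + 1 : ℝ) ^ 2 ≤ (j : ℝ) ^ 2 := by
        rw [← sq_abs (j : ℝ)]
        gcongr
      have : 1 ≤ 1 / (m + 1 : ℝ) ^ 2 * (j : ℝ) ^ 2 := by
        rw [one_div, inv_mul_eq_div, le_div_iff₀ hm]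
        linarith
      linarith

lemma one_sub_div_pow_le_exp (hr : 4 ≤ r) {c : ℝ} (hc : c ≤ 4) :
    (1 - c / r) ^ n ≤ Real.exp (-(c * (n / r))) := by
  have hr' : (4 : ℝ) ≤ r := by exact_mod_cast hr
  have h0 : 0 ≤ 1 - c / r := by
    rw [sub_nonneg, div_le_one (by linarith)]
    linarith
  calc (1 - c / r) ^ n ≤ Real.exp (-(c / r)) ^ n :=
        pow_le_pow_left₀ h0 (by linarith [Real.add_one_le_exp (-(c / r))]) n
    _ = _ := by
        rw [← Real.exp_nat_mul]
        ring_nf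

/-- Two parts have sizes differing by exactly one with a fair probability. -/
lemma diffExpect_abs_eq_one_ge (huv : u ≠ v) (hr : 4 ≤ r) :
    min ((n : ℝ) / r) 1 / (27 * √(max ((n : ℝ) / r) 1)) ≤
      diffExpect n u v fun j => if |j| = 1 then 1 else 0 := by
  set x : ℝ := n / r with hx
  have hx0 : 0 ≤ x := by positivity
  set s : ℝ := √(max x 1) with hs
  have hs1 : 1 ≤ s := by
    rw [hs, Real.one_le_sqrt]
    exact le_max_right _ _
  have hs2 : s ^ 2 = max x 1 := Real.sq_sqrt (by positivity)
  have hsplit : diffExpect n u v (fun j => if |j| = 1 then (1 : ℝ) else 0) =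
      2 * diffMass n u v 1 := by
    rw [two_mul]
    nth_rewrite 2 [← diffMass_neg huv]
    unfold diffMass
    rw [← diffExpect_add]
    congr 1
    funext j
    rcases abs_cases j with ⟨h, _⟩ | ⟨h, _⟩ <;> rw [h] <;> split_ifs <;> first | omega | norm_num
  rw [hsplit]
  -- A few standard deviations: Chebyshev then costs at most `2 / 9 * min x 1`, against a parity
  -- term of at least `2 / 5 * min x 1`, while `2 * m + 1 ≤ 9 * s`.
  set m : ℕ := ⌈3 * s⌉₊ with hm
  have hm1 : 3 * s ≤ m := Nat.le_ceil _
  have hm2 : (m : ℝ) < 3 * s + 1 := Nat.ceil_lt_add_one (by positivity)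
  have h1 := diffMass_one_ge (n := n) huv (by omega : 3 ≤ r) m
  have h2 : (1 - 4 / r : ℝ) ^ n ≤ Real.exp (-(4 * x)) :=
    one_sub_div_pow_le_exp hr le_rfl
  have h3 := one_sub_exp_neg_ge (y := 4 * x) (by positivity)
  have h4 : 4 / 5 * min x 1 ≤ 4 * x / (1 + 4 * x) := by
    rw [le_div_iff₀ (by positivity)]
    rcases le_total x 1 with h | h
    · rw [min_eq_left h]
      nlinarith
    · rw [min_eq_right h]
      nlinarith
  have h5 : 2 * x / (m + 1 : ℝ) ^ 2 ≤ 2 / 9 * min x 1 := by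
    rw [div_le_iff₀ (by positivity)]
    have h6 : 9 * max x 1 ≤ (m + 1 : ℝ) ^ 2 := by
      rw [← hs2]
      nlinarith
    have h7 : min x 1 * max x 1 = x := by rw [min_mul_max, mul_one]
    have h8 : 0 ≤ min x 1 := by positivity
    nlinarith
  rw [div_le_iff₀ (by positivity)]
  have h6 : 0 ≤ min x 1 := by positivity
  have h7 : 0 ≤ diffMass n u v 1 :=
    Finset.expect_nonneg fun P _ => by split_ifs <;> norm_num
  have h8 : (2 * m + 1) * diffMass n u v 1 ≤ 9 * s * diffMass n u v 1 :=
    mul_le_mul_of_nonneg_right (by linarith) h7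
  linarith

/-- Two parts have sizes differing by the order of the standard deviation on average. -/
lemma diffExpect_abs_ge (huv : u ≠ v) (hr : 4 ≤ r) (hn : r ≤ n) :
    √((n : ℝ) / r) / 4 ≤ diffExpect n u v fun j => |(j : ℝ)| := by
  set x : ℝ := n / r with hx
  have hr0 : (0 : ℝ) < r := by exact_mod_cast u.pos
  have hx1 : 1 ≤ x := by
    rw [hx, one_le_div hr0]
    exact_mod_cast hn
  set s : ℝ := √x with hs
  have hs1 : 1 ≤ s := Real.one_le_sqrt.2 hx1
  have hs2 : s ^ 2 = x := Real.sq_sqrt (by positivity)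
  -- At this frequency `s * (1 - cos (θ * j))` lies below `|j|`, and its mean is explicit and of
  -- order `s`.
  set θ : ℝ := 1 / s with hθ
  have hθ0 : 0 < θ := by positivity
  have hθ1 : θ ≤ 1 := by
    rw [hθ, div_le_one (by positivity)]
    exact hs1
  have hmono : diffExpect n u v (fun j => s * (1 - Real.cos (θ * j))) ≤
      diffExpect n u v fun j => |(j : ℝ)| := by
    refine diffExpect_mono fun j => ?_
    have h1 := Real.one_sub_sq_div_two_le_cos (x := θ * j)
    have h2 : 1 - Real.cos (θ * j) ≤ |θ * j| := by
      rcases le_total |θ * j| 2 with h | h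
      · rw [← sq_abs] at h1
        nlinarith [abs_nonneg (θ * j)]
      · linarith [Real.neg_one_le_cos (θ * j)]
    rw [abs_mul, abs_of_pos hθ0] at h2
    have h3 : s * θ = 1 := by rw [hθ]; field_simp
    calc s * (1 - Real.cos (θ * j)) ≤ s * (θ * |(j : ℝ)|) :=
          mul_le_mul_of_nonneg_left h2 (by positivity)
      _ = |(j : ℝ)| := by rw [← mul_assoc, h3, one_mul]
  refine le_trans ?_ hmono
  rw [diffExpect_const_mul, diffExpect_sub, diffExpect_const, diffExpect_cos huv]
  have hpi : θ ≤ Real.pi := hθ1.trans (by linarith [Real.pi_gt_three])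
  have hcos := Real.cos_le_one_sub_mul_cos_sq (x := θ) (by rwa [abs_of_pos hθ0])
  have hpi2 : (1 : ℝ) / 5 ≤ 2 / Real.pi ^ 2 := by
    rw [div_le_div_iff₀ (by norm_num) (by positivity)]
    nlinarith [Real.pi_lt_d2, Real.pi_gt_three]
  have hθ2 : x * θ ^ 2 = 1 := by
    rw [hθ, div_pow, hs2]
    field_simp
  -- With `x * θ ^ 2 = 1` the exponent is at least `2 / 5`, and `1 - exp (-2 / 5) ≥ 2 / 7 > 1 / 4`.
  have hc : θ ^ 2 / 5 ≤ 1 - Real.cos θ := by nlinarith [sq_nonneg θ]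
  have h1 : (1 - 2 / r * (1 - Real.cos θ)) ^ n ≤ Real.exp (-(2 * (1 - Real.cos θ) * x)) := by
    have := one_sub_div_pow_le_exp (n := n) hr (c := 2 * (1 - Real.cos θ))
      (by linarith [Real.neg_one_le_cos θ])
    rwa [show 2 * (1 - Real.cos θ) / (r : ℝ) = 2 / r * (1 - Real.cos θ) by ring] at this
  have h2 : Real.exp (-(2 * (1 - Real.cos θ) * x)) ≤ Real.exp (-(2 / 5)) :=
    Real.exp_le_exp.2 (by nlinarith)
  have h3 := one_sub_exp_neg_ge (y := 2 / 5) (by norm_num)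
  have h4 : (2 / 5 : ℝ) / (1 + 2 / 5) = 2 / 7 := by norm_num
  rw [h4] at h3
  nlinarith

end Difference

/-! ### The two regimes of `r`, the binomial tail, and the final bounds -/

section Assembly

open Finset Filter Topology
open scoped BigOperators

/-- Moving one element changes at most two part sizes, each by one, and each part lies in at most
one pair. -/
lemma abs_sum_pairDiff_update_sub_le {n r h : ℕ} (e : Option (Fin h × Bool) ≃ Fin r) (φ : ℤ → ℝ)
    (hφ : ∀ j k, |φ j - φ k| ≤ |((j - k : ℤ) : ℝ)|) (P : Fin n → Fin r) (j : Fin n) (a : Fin r) :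
    |∑ i, φ (pairDiff e (Function.update P j a) i) - ∑ i, φ (pairDiff e P i)| ≤ 2 := by
  set P' := Function.update P j a with hP'
  set δ : Fin r → ℤ := fun b => (load P' b : ℤ) - load P b with hδ
  have h1 : ∑ b, |δ b| ≤ 2 := by
    calc ∑ b, |δ b| ≤ ∑ b, ((if a = b then 1 else 0) + if P j = b then (1 : ℤ) else 0) := by
          refine Finset.sum_le_sum fun b _ => ?_
          simp only [hδ, hP', load_update]
          split_ifs <;> norm_num
      _ = 2 := by simp [Finset.sum_add_distrib]
  have h2 : ∑ i, (|δ (e (some (i, true)))| + |δ (e (some (i, false)))|) ≤ ∑ b, |δ b| := by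
    rw [← sum_erase_eq_sum_pairs e fun b => |δ b|]
    exact Finset.sum_le_sum_of_subset_of_nonneg (Finset.erase_subset _ _)
      fun _ _ _ => abs_nonneg _
  have h3 : ∀ i, |φ (pairDiff e P' i) - φ (pairDiff e P i)| ≤
      ((|δ (e (some (i, true)))| + |δ (e (some (i, false)))| : ℤ) : ℝ) := fun i => by
    refine (hφ _ _).trans ?_
    rw [← Int.cast_abs, Int.cast_le]
    refine le_trans (le_of_eq ?_) (abs_sub _ _)
    congr 1
    simp only [hδ, pairDiff]
    ring
  rw [← Finset.sum_sub_distrib]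
  refine (Finset.abs_sum_le_sum_abs _ _).trans ((Finset.sum_le_sum fun i _ => h3 i).trans ?_)
  exact_mod_cast h2.trans h1

/-- A sum over the pairs of a Lipschitz function of the difference is rarely small. -/
lemma prob_sum_pairDiff_le {n r h : ℕ} (hn : 0 < n) (e : Option (Fin h × Bool) ≃ Fin r)
    (φ : ℤ → ℝ) (hφ : ∀ j k, |φ j - φ k| ≤ |((j - k : ℤ) : ℝ)|) {c s : ℝ}
    (hc : ∀ u v : Fin r, u ≠ v → c ≤ diffExpect n u v φ) (hs0 : 0 ≤ s) (hs : s ≤ 4 * n) :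
    prob (fun P : Fin n → Fin r => ∑ i, φ (pairDiff e P i) ≤ h * c - s) ≤
      Real.exp (-(s ^ 2 / (16 * n))) := by
  have : Nonempty (Fin r) := ⟨e none⟩
  refine le_trans (prob_mono fun P hP => ?_) (prob_lower_deviation_le hn
    (fun P : Fin n → Fin r => ∑ i, φ (pairDiff e P i))
    (abs_sum_pairDiff_update_sub_le e φ hφ) hs0 hs)
  refine hP.trans (sub_le_sub_right ?_ s)
  rw [Finset.expect_sum_comm]
  calc (h : ℝ) * c = ∑ _i : Fin h, c := by simp
    _ ≤ _ := Finset.sum_le_sum fun i _ => hc (e (some (i, true))) (e (some (i, false))) (by simp)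

/-- Part sizes within a quarter of their mean `x` make every difference at most `x / 2`, below the
workspace size. The target `ν ^ 3` is then covered by the workspace alone if `x ≥ 2 * ν ^ 3`, and
otherwise by the sum of the differences. -/
lemma infeasibleProb_le_of_few_parts {n r h : ℕ} [NeZero r] (hr : r = 2 * h + 1)
    (e : Option (Fin h × Bool) ≃ Fin r) {ν : ℝ} (hν : 2000 ≤ ν) (hn : (n : ℝ) = ν ^ 5)
    (hrν : (r : ℝ) ≤ ν ^ 4) {w : ℕ} (hw : |2 * (w : ℝ) - n| ≤ ν ^ 3) :
    infeasibleProb n (e none) w ≤ 5 * ν ^ 5 * Real.exp (-(ν / 64)) := by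
  have hν0 : 0 < ν := by linarith
  have hr0 : (0 : ℝ) < r := by exact_mod_cast NeZero.pos r
  have hn0 : 0 < n := by
    have : (0 : ℝ) < n := by rw [hn]; positivity
    exact_mod_cast this
  set x : ℝ := (n : ℝ) / r with hx
  have hxr : x * r = ν ^ 5 := by rw [hx, hn]; field_simp
  have hxν : ν ≤ x := by
    rw [hx, le_div_iff₀ hr0, hn]
    nlinarith
  have hν45 : ν ^ 4 ≤ ν ^ 5 := pow_le_pow_right₀ (by linarith) (by norm_num)
  have hν35 : ν ^ 3 ≤ ν ^ 5 := pow_le_pow_right₀ (by linarith) (by norm_num)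
  have hdev : prob (fun P : Fin n → Fin r => ∃ a, x / 4 < |(load P a : ℝ) - x|) ≤
      2 * ν ^ 5 * Real.exp (-(ν / 64)) := by
    refine (prob_exists_le _).trans
      ((Finset.sum_le_sum fun a _ => prob_load_deviation_le a).trans ?_)
    rw [Finset.sum_const, Finset.card_univ, Fintype.card_fin, nsmul_eq_mul, ← hx]
    have h1 : Real.exp (-(x / 64)) ≤ Real.exp (-(ν / 64)) := Real.exp_le_exp.2 (by linarith)
    calc (r : ℝ) * (2 * Real.exp (-(x / 64))) ≤ ν ^ 5 * (2 * Real.exp (-(ν / 64))) := by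
          gcongr
          exact hrν.trans hν45
      _ = _ := by ring
  have hgood : ∀ P : Fin n → Fin r, (∀ a, |(load P a : ℝ) - x| ≤ x / 4) →
      (ν ^ 3 ≤ (3 / 4) * x ∨ ν ^ 3 ≤ ∑ i, |(pairDiff e P i : ℝ)|) →
      (feasibleInputs P (e none) w).Nonempty := by
    intro P hP hor
    have hW := abs_le.1 (hP (e none))
    refine feasibleInputs_nonempty_of_pairDiff_le e P w (fun i => ?_) ?_
    · have h1 := abs_le.1 (hP (e (some (i, true))))
      have h2 := abs_le.1 (hP (e (some (i, false))))
      have : |(pairDiff e P i : ℝ)| ≤ load P (e none) := by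
        simp only [pairDiff]
        push_cast
        rw [abs_le]
        constructor <;> linarith [h1.1, h1.2, h2.1, h2.2, hW.1]
      exact_mod_cast this
    · have h0 : (0 : ℝ) ≤ ∑ i, |(pairDiff e P i : ℝ)| := Finset.sum_nonneg fun _ _ => abs_nonneg _
      have : |2 * (w : ℝ) - n| ≤ load P (e none) + ∑ i, |(pairDiff e P i : ℝ)| := by
        rcases hor with h | h
        · linarith [hW.1]
        · linarith [hW.1]
      exact_mod_cast this
  have hexp0 : 0 < ν ^ 5 * Real.exp (-(ν / 64)) := by positivity
  rcases le_total (2 * ν ^ 3) x with hx2 | hx2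
  · refine (infeasibleProb_le_prob _ w (E := fun P => ∃ a, x / 4 < |(load P a : ℝ) - x|)
      fun P hP => ?_).trans (hdev.trans (by linarith))
    push Not at hP
    exact hgood P hP (Or.inl (by nlinarith [pow_pos hν0 3]))
  · have hrbig : (4 : ℝ) ≤ r := by
      by_contra hlt
      push Not at hlt
      have h1 : x * r < 2 * ν ^ 3 * 4 := by nlinarith [pow_pos hν0 3]
      rw [hxr] at h1
      nlinarith [pow_pos hν0 3]
    have hsum := prob_sum_pairDiff_le hn0 e (fun j => |(j : ℝ)|)
      (fun j k => by push_cast; exact abs_abs_sub_abs_le _ _) (c := √x / 4) (s := ν ^ 3)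
      (fun u v huv => diffExpect_abs_ge huv (by exact_mod_cast hrbig)
        (by exact_mod_cast (hrν.trans hν45).trans_eq hn.symm)) (by positivity)
      (by rw [hn]; linarith [pow_pos hν0 5])
    have hmean : ν ^ 3 ≤ h * (√x / 4) - ν ^ 3 := by
      -- Since `√x * (√x * r) = ν ^ 5`, this gives `√x * r ≥ 24 * ν ^ 3`; with `h ≥ r / 3` the mean
      -- is at least `2 * ν ^ 3`.
      have hsx : √x ≤ ν ^ 2 / 24 := by
        rw [Real.sqrt_le_left (by positivity)]
        nlinarith [pow_pos hν0 3]
      have hs0 : 0 < √x := Real.sqrt_pos.2 (by linarith)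
      have hsq : √x * √x = x := Real.mul_self_sqrt (by linarith)
      have hh : (r : ℝ) / 3 ≤ h := by
        have : (r : ℝ) = 2 * h + 1 := by exact_mod_cast hr
        linarith
      have h1 : √x * (√x * r) = ν ^ 5 := by rw [← mul_assoc, hsq, hxr]
      have h2 : 24 * ν ^ 3 ≤ √x * r := by
        have h3 : ν ^ 5 ≤ ν ^ 2 / 24 * (√x * r) := by
          rw [← h1]
          gcongr
        have h4 : 0 < ν ^ 2 := by positivity
        by_contra hlt
        push Not at hlt
        nlinarith
      nlinarith
    refine (infeasibleProb_le_prob _ w (E := fun P => (∃ a, x / 4 < |(load P a : ℝ) - x|) ∨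
      ∑ i, |(pairDiff e P i : ℝ)| ≤ h * (√x / 4) - ν ^ 3) fun P hP => ?_).trans
      ((prob_or_le _ _).trans ?_)
    · push Not at hP
      exact hgood P hP.1 (Or.inr (by linarith [hP.2]))
    · have h1 : Real.exp (-((ν ^ 3) ^ 2 / (16 * n))) ≤ 3 * ν ^ 5 * Real.exp (-(ν / 64)) := by
        have h2 : (ν ^ 3) ^ 2 / (16 * n) = ν / 16 := by rw [hn]; field_simp
        rw [h2]
        have h3 : Real.exp (-(ν / 16)) ≤ Real.exp (-(ν / 64)) := Real.exp_le_exp.2 (by linarith)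
        have h4 : 1 ≤ ν ^ 5 := one_le_pow₀ (by linarith)
        nlinarith [Real.exp_pos (-(ν / 64))]
      linarith

/-- Now `n / r ≤ ν`, so all parts are below `ν ^ 2` with high probability, while at least `2 * ν ^
3` pairs of difference one appear, more than the `2 * L` needed. -/
lemma infeasibleProb_le_of_many_parts {n r h : ℕ} [NeZero r] (hr : r = 2 * h + 1)
    (e : Option (Fin h × Bool) ≃ Fin r) {ν : ℝ} (hν : 60000 ≤ ν) (hn : (n : ℝ) = ν ^ 5)
    (hrν : ν ^ 4 ≤ (r : ℝ)) {w : ℕ} (hw : |2 * (w : ℝ) - n| ≤ ν ^ 3) :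
    infeasibleProb n (e none) w ≤ 5 * ν ^ 5 * Real.exp (-(ν / 64)) := by
  have hν0 : 0 < ν := by linarith
  have hr0 : (0 : ℝ) < r := by exact_mod_cast NeZero.pos r
  have hn0 : 0 < n := by
    have : (0 : ℝ) < n := by rw [hn]; positivity
    exact_mod_cast this
  have hν1 : 1 ≤ ν ^ 3 := one_le_pow₀ (by linarith)
  have hν4 : 4 ≤ ν ^ 4 := by nlinarith
  have hν34 : 60000 * ν ^ 3 ≤ ν ^ 4 := by nlinarith
  have hν45 : 60000 * ν ^ 4 ≤ ν ^ 5 := by nlinarith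
  have hν23 : 60000 * ν ^ 2 ≤ ν ^ 3 := by nlinarith [pow_pos hν0 2]
  set x : ℝ := (n : ℝ) / r with hx
  have hx0 : 0 ≤ x := by positivity
  have hxr : x * r = ν ^ 5 := by rw [hx, hn]; field_simp
  have hxν : x ≤ ν := by
    rw [hx, div_le_iff₀ hr0, hn]
    nlinarith
  set c : ℝ := min x 1 / (27 * √(max x 1)) with hc
  set L : ℕ := ⌊ν ^ 2⌋₊ with hL
  have hLν : (L : ℝ) ≤ ν ^ 2 := Nat.floor_le (by positivity)
  have hmean : 2 * ν ^ 3 ≤ h * c - ν ^ 3 := by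
    have hh : (r : ℝ) / 3 ≤ h := by
      have : (r : ℝ) = 2 * h + 1 := by exact_mod_cast hr
      linarith
    have hmin : ν ^ 4 ≤ r * min x 1 := by
      rcases le_total x 1 with h | h
      · rw [min_eq_left h]
        nlinarith [pow_pos hν0 4]
      · rw [min_eq_right h, mul_one]
        exact hrν
    have hs0 : 0 < √(max x 1) := Real.sqrt_pos.2 (by positivity)
    -- Here `ν ≥ 243 ^ 2` is needed, hence the threshold 60000; `243 = 3 * 81` turns the `3 * 27` in
    -- `r / 3 * c` into `3 * ν ^ 3`.
    have hs : 243 * √(max x 1) ≤ ν := by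
      have : √(max x 1) ≤ ν / 243 := by
        rw [Real.sqrt_le_left (by positivity)]
        refine (max_le hxν (by linarith)).trans ?_
        nlinarith
      linarith
    have hmin0 : 0 ≤ min x 1 := by positivity
    have h1 : 3 * ν ^ 3 ≤ r / 3 * c := by
      rw [hc, ← mul_div_assoc, le_div_iff₀ (by positivity)]
      nlinarith [pow_pos hν0 3]
    have hc0 : 0 ≤ c := by positivity
    nlinarith
  have hlip : ∀ j k : ℤ, |(if |j| = 1 then (1 : ℝ) else 0) - if |k| = 1 then 1 else 0| ≤
      |((j - k : ℤ) : ℝ)| := by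
    intro j k
    by_cases hjk : j = k
    · simp [hjk]
    · have h1 : (1 : ℝ) ≤ |((j - k : ℤ) : ℝ)| := by
        exact_mod_cast Int.one_le_abs (sub_ne_zero.2 hjk)
      refine le_trans ?_ h1
      split_ifs <;> norm_num
  have hsum := prob_sum_pairDiff_le hn0 e (fun j => if |j| = 1 then (1 : ℝ) else 0) hlip
    (c := c) (s := ν ^ 3)
    (fun u v huv => diffExpect_abs_eq_one_ge huv (by exact_mod_cast hν4.trans hrν)) (by positivity)
    (by rw [hn]; linarith)
  have hmax := prob_exists_load_ge_le (n := n) (r := r) (ℓ := ν ^ 2) (by positivity)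
  refine (infeasibleProb_le_prob _ w (E := fun P => (∃ a, ν ^ 2 ≤ load P a) ∨
    (∑ i, if |pairDiff e P i| = 1 then (1 : ℝ) else 0) ≤ h * c - ν ^ 3) fun P hP => ?_).trans
    ((prob_or_le _ _).trans ?_)
  · push Not at hP
    refine feasibleInputs_nonempty_of_load_le e P w L (fun a => Nat.le_floor (hP.1 a).le) ?_ ?_
    · have h1 : (#{i | |pairDiff e P i| = 1} : ℝ) =
          ∑ i, if |pairDiff e P i| = 1 then (1 : ℝ) else 0 := by
        rw [Finset.card_filter]
        push_cast
        rfl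
      have h2 : (2 * L : ℝ) ≤ #{i | |pairDiff e P i| = 1} := by
        rw [h1]
        linarith [hP.2]
      exact_mod_cast h2
    · have h1 : (L : ℝ) ^ 2 ≤ ν ^ 4 := by
        rw [show ν ^ 4 = (ν ^ 2) ^ 2 by ring]
        gcongr
      have : |2 * (w : ℝ) - n| + L + 4 * (L : ℝ) ^ 2 ≤ n := by
        rw [hn] at hw ⊢
        linarith
      exact_mod_cast this
  · have h1 : Real.exp (-((ν ^ 3) ^ 2 / (16 * n))) ≤ ν ^ 5 * Real.exp (-(ν / 64)) := by
      have h2 : (ν ^ 3) ^ 2 / (16 * n) = ν / 16 := by rw [hn]; field_simp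
      rw [h2]
      have h3 : Real.exp (-(ν / 16)) ≤ Real.exp (-(ν / 64)) := Real.exp_le_exp.2 (by linarith)
      nlinarith [Real.exp_pos (-(ν / 64))]
    have h2 : 2 * n * Real.exp (2 * (n / r)) / (Real.exp (ν ^ 2) - 1) ≤
        4 * ν ^ 5 * Real.exp (-(ν / 64)) := by
      have h3 : 2 ≤ Real.exp (ν ^ 2) := by nlinarith [Real.add_one_le_exp (ν ^ 2)]
      rw [div_le_iff₀ (by linarith), ← hx, hn]
      have h4 : Real.exp (2 * x) ≤ Real.exp (-(ν / 64)) * Real.exp (ν ^ 2) := by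
        rw [← Real.exp_add]
        exact Real.exp_le_exp.2 (by nlinarith)
      have h5 : Real.exp (ν ^ 2) / 2 ≤ Real.exp (ν ^ 2) - 1 := by linarith
      calc 2 * ν ^ 5 * Real.exp (2 * x)
          ≤ 2 * ν ^ 5 * (Real.exp (-(ν / 64)) * Real.exp (ν ^ 2)) := by gcongr
        _ = 4 * ν ^ 5 * Real.exp (-(ν / 64)) * (Real.exp (ν ^ 2) / 2) := by ring
        _ ≤ _ := by gcongr
    linarith

/-- Hoeffding: `2w - n` has exponential moment `cosh t ^ n ≤ exp (n * t ^ 2 / 2)`, optimised at `t =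
s / n`. -/
lemma sum_choose_div_two_pow_tail_le {n : ℕ} (hn : 0 < n) {s : ℝ} (hs : 0 ≤ s) :
    ∑ w : Fin (n + 1), (n.choose w : ℝ) / 2 ^ n * (if s < |2 * (w : ℝ) - n| then 1 else 0) ≤
      2 * Real.exp (-(s ^ 2 / (2 * n))) := by
  have hn' : (0 : ℝ) < n := by exact_mod_cast hn
  set t : ℝ := s / n with ht
  have ht0 : 0 ≤ t := by positivity
  have hmgf : ∑ w : Fin (n + 1), (n.choose w : ℝ) / 2 ^ n * Real.exp (t * (2 * (w : ℝ) - n)) =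
      Real.cosh t ^ n := by
    rw [Real.cosh_eq, div_pow, add_pow, Finset.sum_div,
      Fin.sum_univ_eq_sum_range (fun w => (n.choose w : ℝ) / 2 ^ n * Real.exp (t * (2 * w - n)))]
    refine Finset.sum_congr rfl fun w hw => ?_
    rw [← Real.exp_nat_mul, ← Real.exp_nat_mul, ← Real.exp_add,
      Nat.cast_sub (Nat.le_of_lt_succ (Finset.mem_range.1 hw))]
    rw [show (w : ℝ) * t + ((n : ℝ) - w) * -t = t * (2 * w - n) by ring]
    ring
  have hmgf' : ∑ w : Fin (n + 1), (n.choose w : ℝ) / 2 ^ n * Real.exp (-(t * (2 * (w : ℝ) - n))) =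
      Real.cosh t ^ n := by
    rw [← hmgf, ← Equiv.sum_comp Fin.revPerm]
    refine Finset.sum_congr rfl fun w _ => ?_
    have hw := Nat.le_of_lt_succ w.2
    have : ((Fin.revPerm w : Fin (n + 1)) : ℕ) = n - w := by
      simp [Fin.revPerm, Fin.val_rev]
    rw [this, Nat.choose_symm hw, Nat.cast_sub hw]
    ring_nf
  have hcosh : Real.cosh t ^ n ≤ Real.exp (s ^ 2 / (2 * n)) := by
    calc Real.cosh t ^ n ≤ Real.exp (t ^ 2 / 2) ^ n :=
          pow_le_pow_left₀ (Real.cosh_pos t).le (Real.cosh_le_exp_half_sq t) n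
      _ = _ := by
          rw [← Real.exp_nat_mul, ht]
          congr 1
          field_simp
  have hpt : ∀ y : ℝ, (if s < |y| then (1 : ℝ) else 0) ≤
      Real.exp (-(t * s)) * (Real.exp (t * y) + Real.exp (-(t * y))) := by
    intro y
    split_ifs with h
    · rw [mul_add, ← Real.exp_add, ← Real.exp_add]
      rcases lt_abs.1 h with h | h
      · have : 1 ≤ Real.exp (-(t * s) + t * y) := Real.one_le_exp (by nlinarith)
        linarith [Real.exp_pos (-(t * s) + -(t * y))]
      · have : 1 ≤ Real.exp (-(t * s) + -(t * y)) := Real.one_le_exp (by nlinarith)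
        linarith [Real.exp_pos (-(t * s) + t * y)]
    · positivity
  calc _ ≤ ∑ w : Fin (n + 1), (n.choose w : ℝ) / 2 ^ n * (Real.exp (-(t * s)) *
        (Real.exp (t * (2 * (w : ℝ) - n)) + Real.exp (-(t * (2 * (w : ℝ) - n))))) :=
        Finset.sum_le_sum fun w _ => mul_le_mul_of_nonneg_left (hpt _) (by positivity)
    _ = Real.exp (-(t * s)) * (Real.cosh t ^ n + Real.cosh t ^ n) := by
        nth_rewrite 1 [← hmgf]
        rw [← hmgf', ← Finset.sum_add_distrib, Finset.mul_sum]
        refine Finset.sum_congr rfl fun w _ => ?_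
        ring
    _ ≤ Real.exp (-(t * s)) * (2 * Real.exp (s ^ 2 / (2 * n))) := by
        gcongr
        linarith
    _ = _ := by
        rw [mul_left_comm, ← Real.exp_add, ht]
        congr 2
        field_simp
        ring

lemma sum_choose_div_two_pow_real (n : ℕ) :
    ∑ w : Fin (n + 1), (n.choose w : ℝ) / 2 ^ n = 1 := by
  have := (binomialHalf n).sum_toReal
  simpa only [toReal_binomialHalf] using this

/-- Weights with `|2w - n| > ν ^ 3` are charged in full, through the binomial tail; the others fall
under one of the two regimes. -/
lemma tvDist_randomWorkspaceDist_le_exp {n r : ℕ} [NeZero r] (hr : Odd r) {ν : ℝ}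
    (hν : 60000 ≤ ν) (hn : (n : ℝ) = ν ^ 5) :
    tvDist (randomWorkspaceDist n r) (PMF.uniformOfFintype (Fin n → Bool)) ≤
      7 * ν ^ 5 * Real.exp (-(ν / 64)) := by
  have hν0 : 0 < ν := by linarith
  have hn0 : 0 < n := by
    have : (0 : ℝ) < n := by rw [hn]; positivity
    exact_mod_cast this
  set δ : ℝ := 5 * ν ^ 5 * Real.exp (-(ν / 64)) with hδ
  have hδ0 : 0 ≤ δ := by positivity
  have hle : ∀ w : Fin (n + 1), 𝔼 W : Fin r, infeasibleProb n W w ≤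
      δ + if ν ^ 3 < |2 * (w : ℝ) - n| then 1 else 0 := by
    intro w
    rw [← Fintype.expect_const (ι := Fin r) (δ + if ν ^ 3 < |2 * (w : ℝ) - n| then 1 else 0)]
    refine Finset.expect_le_expect fun W _ => ?_
    split_ifs with h
    · linarith [infeasibleProb_le_one n W w]
    · rw [add_zero]
      push Not at h
      obtain ⟨m, e, hm, rfl⟩ := exists_pairing hr W
      rcases le_total (r : ℝ) (ν ^ 4) with h4 | h4
      · exact infeasibleProb_le_of_few_parts hm e (by linarith) hn h4 h
      · exact infeasibleProb_le_of_many_parts hm e hν hn h4 h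
  refine (tvDist_randomWorkspaceDist_le n r).trans ((Finset.sum_le_sum fun w _ =>
    mul_le_mul_of_nonneg_left (hle w) (by positivity)).trans ?_)
  simp_rw [mul_add]
  rw [Finset.sum_add_distrib, ← Finset.sum_mul, sum_choose_div_two_pow_real, one_mul]
  have htail := sum_choose_div_two_pow_tail_le hn0 (s := ν ^ 3) (by positivity)
  have h1 : (ν ^ 3) ^ 2 / (2 * n) = ν / 2 := by rw [hn]; field_simp
  rw [h1] at htail
  have h2 : Real.exp (-(ν / 2)) ≤ Real.exp (-(ν / 64)) := Real.exp_le_exp.2 (by linarith)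
  have h3 : 1 ≤ ν ^ 5 := one_le_pow₀ (by linarith)
  nlinarith [Real.exp_pos (-(ν / 64))]

lemma tvDist_randomWorkspaceDist_le_sq_div (n r : ℕ) [NeZero r] :
    tvDist (randomWorkspaceDist n r) (PMF.uniformOfFintype (Fin n → Bool)) ≤ (n : ℝ) ^ 2 / r := by
  have hle : ∀ w : Fin (n + 1), 𝔼 W : Fin r, infeasibleProb n W w ≤ (n : ℝ) ^ 2 / r := by
    intro w
    rw [← Fintype.expect_const (ι := Fin r) ((n : ℝ) ^ 2 / r)]
    refine Finset.expect_le_expect fun W _ => ?_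
    refine (infeasibleProb_le_prob W w (E := fun P => ¬Function.Injective P)
      fun P hP => ?_).trans prob_not_injective_le
    push Not at hP
    refine feasibleInputs_nonempty_of_load_le_one P W (Nat.le_of_lt_succ w.2) fun a => ?_
    refine Finset.card_le_one.2 fun i hi j hj => hP ?_
    simp only [Finset.mem_filter, Finset.mem_univ, true_and] at hi hj
    rw [hi, hj]
  refine (tvDist_randomWorkspaceDist_le n r).trans ((Finset.sum_le_sum fun w _ =>
    mul_le_mul_of_nonneg_left (hle w) (by positivity)).trans ?_)
  rw [← Finset.sum_mul, sum_choose_div_two_pow_real, one_mul]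

lemma exists_forall_tvDist_randomWorkspaceDist_le {ε : ℝ} (hε : 0 < ε) :
    ∃ N : ℕ, ∀ n : ℕ, N ≤ n → ∀ (r : ℕ) [NeZero r], Odd r →
      tvDist (randomWorkspaceDist n r) (PMF.uniformOfFintype (Fin n → Bool)) ≤ ε / (n : ℝ) := by
  have hroot : Tendsto (fun n : ℕ => (n : ℝ) ^ (1 / 5 : ℝ)) atTop atTop :=
    (tendsto_rpow_atTop (by norm_num)).comp tendsto_natCast_atTop_atTop
  -- The power 10 is the `ν ^ 5` of the bound times `n = ν ^ 5`.
  have hdecay : Tendsto (fun ν : ℝ => 7 * 64 ^ 10 * ((ν / 64) ^ 10 * Real.exp (-(ν / 64)))) atTop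
      (𝓝 (7 * 64 ^ 10 * 0)) :=
    ((Real.tendsto_pow_mul_exp_neg_atTop_nhds_zero 10).comp
      (tendsto_id.atTop_div_const (by norm_num))).const_mul _
  rw [mul_zero] at hdecay
  obtain ⟨N, hN⟩ := eventually_atTop.1 (hroot.eventually
    ((hdecay.eventually_le_const hε).and (eventually_ge_atTop 60000)))
  refine ⟨N, fun n hn r _ hr => ?_⟩
  obtain ⟨h1, h2⟩ := hN n hn
  set ν : ℝ := (n : ℝ) ^ (1 / 5 : ℝ) with hν
  have hnν : (n : ℝ) = ν ^ 5 := by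
    rw [hν, ← Real.rpow_natCast, ← Real.rpow_mul (Nat.cast_nonneg n)]
    norm_num
  refine (tvDist_randomWorkspaceDist_le_exp hr h2 hnν).trans ?_
  have hν0 : 0 < ν := by linarith
  rw [le_div_iff₀ (by rw [hnν]; positivity), hnν]
  refine le_trans (le_of_eq ?_) h1
  ring

end Assembly

theorem mainTheorem9 :
    (∀ ε : ℝ, 0 < ε → ∃ N : ℕ, ∀ n : ℕ, N ≤ n → ∀ (r : ℕ) [NeZero r], Odd r →
      tvDist (randomWorkspaceDist n r) (PMF.uniformOfFintype (Fin n → Bool)) ≤ ε / (n : ℝ)) ∧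
    (∀ c : ℝ, 0 < c → c < 1 → ∃ C : ℝ, 0 < C ∧
      ∀ (n k : ℕ) (J : Fin k ↪ Fin n) (r : ℕ) [NeZero r], 1 ≤ k → Odd r →
        C * (k : ℝ) ^ 2 ≤ (r : ℝ) →
        tvDist ((randomWorkspaceDist n r).map (coreInput J)) (coreDist k n) ≤ c / (k : ℝ)) := by
  refine ⟨fun ε hε => exists_forall_tvDist_randomWorkspaceDist_le hε, fun c hc _ => ?_⟩
  obtain ⟨N, hN⟩ := exists_forall_tvDist_randomWorkspaceDist_le hc
  -- For `n ≥ N` the first claim suffices, as `k ≤ n`. For `n ≤ N` the birthday bound `n ^ 2 / r`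
  -- must be at most `c / k`, and `n ^ 2 * k ≤ (N + 1) ^ 3`.
  refine ⟨((N : ℝ) + 1) ^ 3 / c, by positivity, fun n k J r _ hk hr hrC => ?_⟩
  have hkn : k ≤ n := by simpa using Fintype.card_le_of_embedding J
  have hk1 : (1 : ℝ) ≤ k := by exact_mod_cast hk
  have hkn' : (k : ℝ) ≤ n := by exact_mod_cast hkn
  rw [← map_coreInput_uniform J]
  refine (tvDist_map_le _ _ _).trans ?_
  rcases le_total N n with h | h
  · exact (hN n h r hr).trans (by gcongr)
  · refine (tvDist_randomWorkspaceDist_le_sq_div n r).trans ?_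
    have hr0 : (0 : ℝ) < r := by exact_mod_cast NeZero.pos r
    have hnN : (n : ℝ) ≤ N := by exact_mod_cast h
    have h1 : ((N : ℝ) + 1) ^ 3 ≤ c * r := by
      have h2 : ((N : ℝ) + 1) ^ 3 / c ≤ r := by
        refine le_trans ?_ hrC
        exact le_mul_of_one_le_right (by positivity) (one_le_pow₀ hk1)
      rwa [div_le_iff₀' hc] at h2
    rw [div_le_div_iff₀ hr0 (by linarith)]
    calc (n : ℝ) ^ 2 * k ≤ ((N : ℝ) + 1) ^ 2 * ((N : ℝ) + 1) := by
          gcongr <;> linarith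
      _ = ((N : ℝ) + 1) ^ 3 := by ring
      _ ≤ c * r := h1
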